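/- Let $H\in\mathbb N$, let $\mathcal X,\mathcal A$ be finite nonempty sets, and consider episodic MDPs $\mathcal M$ with periods $t=0,\dots,H-1$. Choosing $a_t$ in state $x_t$ of period $t$ produces an outcome $o=(r_{t+1},x_{t+1})\in\{0,1\}\times\mathcal X$ drawn from $\mathcal P^O_{t,x_t,a_t}$, and the episode stops after the outcome of period $H-1$ (whose state component is irrelevant). Initial states are drawn from a fixed distribution $\rho$ on $\mathcal X$. Put $V^\pi_{\mathcal M,t}(x)=\mathbb E_{\mathcal M,\pi}\big[\sum_{s=t}^{H-1}r_{s+1}\mid x_t=x\big]$, $V^*_{\mathcal M,t}=\max_\pi V^\pi_{\mathcal M,t}$ and, for $t<H$, $Q^*_{\mathcal M,t}(x,a)=\mathbb E[r_{t+1}+V^*_{\mathcal M,t+1}(x_{t+1})\mid \mathcal M,x_t=x,a_t=a]$; $Q^*_{\mathcal M,H}=0$. Prior: the distributions $\mathcal P^O_{t,x,a}$, $(t,x,a)\in\{0,\dots,H-1\}\times\mathcal X\times\mathcal A$, are random and independent, with $\mathcal P^O_{t,x,a}\sim\mathrm{Dirichlet}(\alpha_{0,t,x,a})$, where $\alpha_{0,t,x,a}$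 has positive entries whose sum is $\beta$ for all $(t,x,a)$, and $\beta\ge 2$. RLSVI with parameters $(\bar\theta,v,\lambda)$: before episode $\ell\ge 1$, let $D_{\ell-1}(y)$ be the list of all outcomes observed in episodes $1,\dots,\ell-1$ at the triple $y=(t,x,a)$, $n_\ell(y)$ its length, and $\sigma_\ell^2(y)=\big(\tfrac1\lambda+\tfrac{n_\ell(y)}{v}\big)^{-1}$. Set $Q_{\ell,H}=0$ and, for $t=H-1,\dots,0$ and $y=(t,x,a)$, $$Q_{\ell,t}(x,a)=\sigma_\ell^2(y)\Big(\frac{\bar\theta_y}{\lambda}+\frac1v\sum_{(r,x')\in D_{\ell-1}(y)}\big(r+\max_{a'\in\mathcal A}Q_{\ell,t+1}(x',a')\big)\Big)+w_\ell(y),$$ where $w_\ell(y)=\sigma_\ell(y)z_\ell(y)$ and the $z_\ell(y)\sim N(0,1)$ are independent across $\ell$ and $y$ and independent of $\mathcal M$ and of the history. In episode $\ell$ the action $a_t\in\arg\max_a Q_{\ell,t}(x_t,a)$ is taken (ties broken by a measurable rule). Let $\mathcal H_{\ell-1}$ be the data (triples and outcomes) recorded in episodes $1,\dots,\ell-1$.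 For random variables $X,Y$, write $X\succeq_{SO}Y$ if $\mathbb E[u(X)]\ge\mathbb E[u(Y)]$ for every convex increasing (that is, nondecreasing) $u:\mathbb R\to\mathbb R$, expectations taking values in $(-\infty,\infty]$. Statement. If $v/\lambda=\beta$, $v\ge H^2$ and $\min_y\bar\theta_y\ge H$, then for every episode $\ell\ge1$, every history $h$ with $\mathbb P(\mathcal H_{\ell-1}=h)>0$ and every $(x,a)\in\mathcal X\times\mathcal A$, under the conditional law given $\mathcal H_{\ell-1}=h$ the variables $Q_{\ell,0}(x,a)$ and $Q^*_{\mathcal M,0}(x,a)$ are integrable and $$Q_{\ell,0}(x,a)\mid\mathcal H_{\ell-1}=h\ \succeq_{SO}\ Q^*_{\mathcal M,0}(x,a)\mid\mathcal H_{\ell-1}=h .$$ -/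

import Mathlib

open MeasureTheory ProbabilityTheory
open scoped ENNReal

namespace RLSVI

noncomputable section

/-! ### Stochastic optimism -/

/-- The expectation of a real random variable as an extended real number,
`E[f⁺] - E[f⁻]`; it is the usual expectation, with values in `(-∞, ∞]`, as soon as
`E[f⁻] < ∞`. -/
def expectation {Ω : Type*} [MeasurableSpace Ω] (μ : Measure Ω) (f : Ω → ℝ) : EReal :=
  ((∫⁻ ω, ENNReal.ofReal (f ω) ∂μ : ℝ≥0∞) : EReal) -
    ((∫⁻ ω, ENNReal.ofReal (-f ω) ∂μ : ℝ≥0∞) : EReal)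

/-- `X` is stochastically optimistic with respect to `Y` under `μ`: `E[u(X)] ≥ E[u(Y)]` for all
convex increasing `u : ℝ → ℝ`. -/
def StochasticallyOptimistic {Ω : Type*} [MeasurableSpace Ω] (μ : Measure Ω) (X Y : Ω → ℝ) :
    Prop :=
  ∀ u : ℝ → ℝ, ConvexOn ℝ Set.univ u → Monotone u →
    expectation μ (fun ω => u (Y ω)) ≤ expectation μ (fun ω => u (X ω))

/-! ### The Dirichlet distribution -/

/-- The Dirichlet distribution with positive parameters `α`, as a law on `ℝ^ι`: the law of
`g / ∑ g` where the `g i` are independent `Gamma (α i, 1)` variables. -/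
def dirichletVec {ι : Type*} [Fintype ι] (α : ι → ℝ) : Measure (ι → ℝ) :=
  (Measure.pi fun i => gammaMeasure (α i) 1).map fun g i => g i / ∑ j, g j

/-- The Dirichlet distribution as a law on the probability simplex. -/
def dirichlet {ι : Type*} [Fintype ι] (α : ι → ℝ) : Measure (stdSimplex ℝ ι) :=
  (dirichletVec α).comap Subtype.val

theorem dirichletVec_ae_mem {ι : Type*} [Fintype ι] [Nonempty ι] (α : ι → ℝ)
    (hα : ∀ i, 0 < α i) : ∀ᵐ p ∂dirichletVec α, p ∈ stdSimplex ℝ ι := by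
  have hp : ∀ i, IsProbabilityMeasure (gammaMeasure (α i) 1) := fun i =>
    isProbabilityMeasure_gammaMeasure (hα i) one_pos
  have hpos : ∀ i, ∀ᵐ x ∂gammaMeasure (α i) 1, 0 < x := by
    intro i
    have h0 : gammaMeasure (α i) 1 (Set.Iic 0) = 0 := by
      rw [gammaMeasure, withDensity_apply _ measurableSet_Iic, setLIntegral_congr Iio_ae_eq_Iic.symm]
      exact lintegral_gammaPDF_of_nonpos le_rfl
    rw [ae_iff]
    convert h0 using 2
    ext x
    simp
  have hall : ∀ᵐ g ∂Measure.pi fun i => gammaMeasure (α i) 1, ∀ i, 0 < g i :=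
    ae_all_iff.2 fun i => (Measure.quasiMeasurePreserving_eval _ i).ae (hpos i)
  rw [dirichletVec]
  refine (ae_map_iff (p := fun p => p ∈ stdSimplex ℝ ι)
    (Measurable.aemeasurable (by fun_prop)) (isClosed_stdSimplex ℝ ι).measurableSet).2 ?_
  filter_upwards [hall] with g hg
  have hs : 0 < ∑ j, g j := Finset.sum_pos (fun i _ => hg i) Finset.univ_nonempty
  refine ⟨fun i => (div_pos (hg i) hs).le, ?_⟩
  rw [← Finset.sum_div, div_self hs.ne']

theorem isProbabilityMeasure_dirichlet {ι : Type*} [Fintype ι] [Nonempty ι] (α : ι → ℝ)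
    (hα : ∀ i, 0 < α i) : IsProbabilityMeasure (dirichlet α) := by
  have hp : ∀ i, IsProbabilityMeasure (gammaMeasure (α i) 1) := fun i =>
    isProbabilityMeasure_gammaMeasure (hα i) one_pos
  have : IsProbabilityMeasure (dirichletVec α) :=
    Measure.isProbabilityMeasure_map (Measurable.aemeasurable (by fun_prop))
  refine (MeasurableEmbedding.subtype_coe
    (isClosed_stdSimplex ℝ ι).measurableSet).isProbabilityMeasure_comap ?_
  filter_upwards [dirichletVec_ae_mem α hα] with p hp
  exact ⟨⟨p, hp⟩, rfl⟩

/-! ### Finite-horizon time-inhomogeneous MDPs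

States are pairs `(t, x)` with `t < H` and `x : X`.  An outcome is a pair `(r, x')` of a reward
in `{0, 1}` and a next state. -/

/-- Triples `y = (t, x, a)`. -/
abbrev Triple (H : ℕ) (X A : Type*) := Fin H × X × A

/-- Outcomes `o = (r, x')`. -/
abbrev Outcome (X : Type*) := Fin 2 × X

/-- The MDP `M`, given by its outcome distributions `P^O_{t,x,a}`. In the last period `t = H - 1`
the state component of the outcome plays no role, since the episode stops. -/
abbrev MDP (H : ℕ) (X A : Type*) [Fintype X] := Triple H X A → stdSimplex ℝ (Outcome X)

/-- Policies `π = (π_0, …, π_{H-1})`. -/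
abbrev Policy (H : ℕ) (X A : Type*) := Fin H → X → A

/-- A recorded transition: the triple `(t, x_t, a_t)` and its outcome `(r_{t+1}, x_{t+1})`. -/
abbrev Transition (H : ℕ) (X A : Type*) := Triple H X A × Outcome X

/-- The data of one episode, in chronological order. -/
abbrev Episode (H : ℕ) (X A : Type*) := List (Transition H X A)

/-- A history: the data of the past episodes, in chronological order. -/
def History (H : ℕ) (X A : Type*) := List (Episode H X A)

instance (H : ℕ) (X A : Type*) : MeasurableSpace (History H X A) := ⊤

instance (H : ℕ) (X A : Type*) : DiscreteMeasurableSpace (History H X A) := ⟨fun _ => trivial⟩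

instance (H : ℕ) (X A : Type*) [Countable X] [Countable A] : Countable (History H X A) :=
  inferInstanceAs (Countable (List (List (Transition H X A))))

/-- The infinite buffer: all transitions recorded in a history. -/
def History.buffer {H : ℕ} {X A : Type*} (h : History H X A) : List (Transition H X A) :=
  List.flatten h

section MDP

variable {H : ℕ} {X A : Type*} [Fintype X]

/-- A point of the simplex as a probability mass function. -/
def toPMF {ι : Type*} [Fintype ι] (p : stdSimplex ℝ ι) : PMF ι :=
  PMF.ofFintype (fun i => ENNReal.ofReal (p.1 i)) (by
    rw [← ENNReal.ofReal_sum_of_nonneg (fun i _ => p.2.1 i), p.2.2, ENNReal.ofReal_one])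

/-- The law of the data recorded when `π` is followed in `M` from state `x` in period `t` to the
end of the episode. -/
def rollout (M : MDP H X A) (π : Policy H X A) (t : ℕ) (x : X) : PMF (Episode H X A) :=
  if ht : t < H then
    (toPMF (M (⟨t, ht⟩, x, π ⟨t, ht⟩ x))).bind fun o =>
      (rollout M π (t + 1) o.2).map fun e => ((⟨t, ht⟩, x, π ⟨t, ht⟩ x), o) :: e
  else PMF.pure []
termination_by H - t

/-- The sum of the rewards recorded in (a part of) an episode. -/
def totalReward (e : Episode H X A) : ℝ := (e.map fun τ => (τ.2.1 : ℝ)).sum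

/-- `V^π_{M,t}(x)`: the expected sum of rewards from period `t` on. The sum has only finitely many
nonzero terms. -/
def policyValue (M : MDP H X A) (π : Policy H X A) (t : ℕ) (x : X) : ℝ :=
  ∑' e, (rollout M π t x e).toReal * totalReward e

theorem measurable_toPMF_apply {ι : Type*} [Fintype ι] (i : ι) :
    Measurable fun p : stdSimplex ℝ ι => toPMF p i :=
  ENNReal.measurable_ofReal.comp ((measurable_pi_apply i).comp measurable_subtype_coe)

theorem measurable_rollout_apply [Countable A] (π : Policy H X A) (t : ℕ) (x : X) (e : Episode H X A) :
    Measurable fun M : MDP H X A => rollout M π t x e := by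
  classical
  induction hm : H - t generalizing t x e with
  | zero =>
    have ht : ¬ t < H := by omega
    unfold rollout
    simp only [ht, dite_false]
    exact measurable_const
  | succ m ih =>
    have ht : t < H := by omega
    have : (fun M : MDP H X A => rollout M π t x e) = fun M =>
        ∑' o : Outcome X, toPMF (M (⟨t, ht⟩, x, π ⟨t, ht⟩ x)) o *
          ∑' e', if e = ((⟨t, ht⟩, x, π ⟨t, ht⟩ x), o) :: e' then rollout M π (t + 1) o.2 e'
            else 0 := by
      funext M
      rw [rollout, dif_pos ht]
      simp only [PMF.bind_apply, PMF.map_apply]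
      refine tsum_congr fun o => congrArg _ (tsum_congr fun e' => ?_)
      split_ifs <;> rfl
    rw [this]
    refine Measurable.tsum fun o => Measurable.mul ?_ (Measurable.tsum fun e' => ?_)
    · exact (measurable_toPMF_apply o).comp (measurable_pi_apply _)
    · split_ifs
      · exact ih (t + 1) o.2 e' (by omega)
      · exact measurable_const

variable [Fintype A] [Nonempty A]

/-- `V*_{M,t}(x) = max_π V^π_{M,t}(x)`. -/
def optValue [DecidableEq X] (M : MDP H X A) (t : ℕ) (x : X) : ℝ :=
  Finset.univ.sup' Finset.univ_nonempty fun π : Policy H X A => policyValue M π t x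

/-- `Q*_{M,t}(x, a) = E[r_{t+1} + V*_{M,t+1}(x_{t+1}) | M, x_t = x, a_t = a]` for `t < H`, and
`Q*_{M,t} = 0` for `t ≥ H`. -/
def optQ [DecidableEq X] (M : MDP H X A) (t : ℕ) (x : X) (a : A) : ℝ :=
  if ht : t < H then
    ∑ o : Outcome X, (M (⟨t, ht⟩, x, a)).1 o * ((o.1 : ℝ) + optValue M (t + 1) o.2)
  else 0

end MDP

/-! ### RLSVI with a tabular representation, an infinite buffer and greedy actions -/

/-- The parameters of tabular RLSVI: prior mean `θ̄`, noise variance `v`, regularization `λ`, and a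
measurable rule that selects a maximizing action (the tie-breaking of the greedy policy). -/
structure Agent (H : ℕ) (X A : Type*) where
  /-- The prior mean `θ̄`. -/
  priorMean : Triple H X A → ℝ
  /-- The noise variance `v`. -/
  v : ℝ
  /-- The regularization parameter `λ`. -/
  lam : ℝ
  /-- The greedy choice. -/
  select : (A → ℝ) → A
  measurableSet_select : ∀ a, MeasurableSet {q : A → ℝ | select q = a}
  le_select : ∀ (q : A → ℝ) (a : A), q a ≤ q (select q)

namespace Agent

variable {H : ℕ} {X A : Type*} [DecidableEq X] [DecidableEq A]

/-- The data `D(y)` of a buffer `D`: the outcomes observed at the triple `y` (with repetitions). -/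
def outcomes (D : List (Transition H X A)) (y : Triple H X A) : List (Outcome X) :=
  (D.filter fun τ => τ.1 = y).map Prod.snd

/-- `σ²(y) = (1/λ + n(y)/v)⁻¹`. -/
def variance (ag : Agent H X A) (D : List (Transition H X A)) (y : Triple H X A) : ℝ :=
  (1 / ag.lam + ((outcomes D y).length : ℝ) / ag.v)⁻¹

variable [Fintype A] [Nonempty A]

/-- The Bellman operator `F_t` of RLSVI with buffer `D` and noise `w = σ z`, applied to `Q`. -/
def bellman (ag : Agent H X A) (D : List (Transition H X A)) (z : Triple H X A → ℝ)
    (t : Fin H) (Q : X → A → ℝ) (x : X) (a : A) : ℝ :=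
  ag.variance D (t, x, a) *
      (ag.priorMean (t, x, a) / ag.lam +
        1 / ag.v * ((outcomes D (t, x, a)).map fun o =>
          (o.1 : ℝ) + Finset.univ.sup' Finset.univ_nonempty fun a' => Q o.2 a').sum) +
    √(ag.variance D (t, x, a)) * z (t, x, a)

/-- The sampled functions: `Q_t = F_t Q_{t+1}` for `t < H` and `Q_t = 0` for `t ≥ H`. -/
def sampleQ (ag : Agent H X A) (D : List (Transition H X A)) (z : Triple H X A → ℝ) (t : ℕ) :
    X → A → ℝ :=
  if ht : t < H then ag.bellman D z ⟨t, ht⟩ (sampleQ ag D z (t + 1)) else fun _ _ => 0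
termination_by H - t

/-- The greedy policy with respect to `(Q_0, …, Q_{H-1})`. -/
def greedy (ag : Agent H X A) (D : List (Transition H X A)) (z : Triple H X A → ℝ) :
    Policy H X A :=
  fun t x => ag.select (ag.sampleQ D z t x)

theorem measurable_sampleQ (ag : Agent H X A) (D : List (Transition H X A)) (t : ℕ) (x : X)
    (a : A) : Measurable fun z => ag.sampleQ D z t x a := by
  induction hm : H - t generalizing t x a with
  | zero =>
    have ht : ¬ t < H := by omega
    have : (fun z => ag.sampleQ D z t x a) = fun _ => 0 := by
      funext z
      rw [sampleQ, dif_neg ht]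
    rw [this]
    exact measurable_const
  | succ m ih =>
    have ht : t < H := by omega
    have key : ∀ x' a', Measurable fun z => ag.sampleQ D z (t + 1) x' a' :=
      fun x' a' => ih (t + 1) x' a' (by omega)
    have hmax : ∀ x', Measurable fun z => Finset.univ.sup' Finset.univ_nonempty
        fun a' => ag.sampleQ D z (t + 1) x' a' := by
      intro x'
      have h := Finset.measurable_sup' (s := Finset.univ) Finset.univ_nonempty
        (f := fun a' z => ag.sampleQ D z (t + 1) x' a') (fun a' _ => key x' a')
      convert h using 1
      ext z
      simp [Finset.sup'_apply]
    have hsum : ∀ l : List (Outcome X), Measurable fun z => (l.map fun o =>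
        (o.1 : ℝ) + Finset.univ.sup' Finset.univ_nonempty
          fun a' => ag.sampleQ D z (t + 1) o.2 a').sum := by
      intro l
      induction l with
      | nil => simp
      | cons o l ihl =>
        simp only [List.map_cons, List.sum_cons]
        exact ((hmax o.2).const_add _).add ihl
    have hs := hsum (outcomes D (⟨t, ht⟩, x, a))
    have : (fun z => ag.sampleQ D z t x a) = fun z =>
        ag.bellman D z ⟨t, ht⟩ (ag.sampleQ D z (t + 1)) x a := by
      funext z
      rw [sampleQ, dif_pos ht]
    rw [this]
    unfold bellman
    exact (((hs.const_mul _).const_add _).const_mul _).add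
      ((measurable_pi_apply _).const_mul _)

variable [Fintype X]

theorem measurableSet_greedy (ag : Agent H X A) (D : List (Transition H X A))
    (π : Policy H X A) : MeasurableSet {z | ag.greedy D z = π} := by
  have : {z | ag.greedy D z = π} =
      ⋂ t : Fin H, ⋂ x : X, {z | ag.select (ag.sampleQ D z t x) = π t x} := by
    ext z
    simp [funext_iff, greedy]
  rw [this]
  refine MeasurableSet.iInter fun t => MeasurableSet.iInter fun x => ?_
  exact (measurable_pi_lambda _ fun a => ag.measurable_sampleQ D t x a)
    (ag.measurableSet_select (π t x))

/-- The standardized noise `z(y) = w(y)/σ(y)`: independent standard Gaussians. -/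
def noise (H : ℕ) (X A : Type*) [Fintype X] [Fintype A] : Measure (Triple H X A → ℝ) :=
  Measure.pi fun _ => gaussianReal 0 1

instance : IsProbabilityMeasure (noise H X A) := by unfold noise; infer_instance

/-- The law of the policy that RLSVI applies in an episode with buffer `D`. -/
def policyLaw (ag : Agent H X A) (D : List (Transition H X A)) : PMF (Policy H X A) :=
  PMF.ofFintype (fun π => noise H X A {z | ag.greedy D z = π}) (by
    rw [← tsum_fintype (L := .unconditional _), ← measure_iUnion _ fun π => ag.measurableSet_greedy D π]
    · rw [← measure_univ (μ := noise H X A)]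
      congr 1
      ext z
      simp
    · intro π π' hne
      refine Set.disjoint_left.2 fun z hz hz' => hne ?_
      exact Eq.symm (show ag.greedy D z = π from hz) |>.trans hz')

/-- The law of the history of the first `n` episodes when RLSVI interacts with the MDP `M`, with
initial states drawn from `ρ`. -/
def historyLaw (ag : Agent H X A) (ρ : PMF X) (M : MDP H X A) : ℕ → PMF (History H X A)
  | 0 => PMF.pure []
  | n + 1 =>
    (historyLaw ag ρ M n).bind fun h =>
      (ag.policyLaw h.buffer).bind fun π =>
        ρ.bind fun x => (rollout M π 0 x).map fun e => List.append h [e]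

theorem measurable_historyLaw_apply (ag : Agent H X A) (ρ : PMF X) (n : ℕ)
    (h : History H X A) : Measurable fun M : MDP H X A => ag.historyLaw ρ M n h := by
  classical
  induction n generalizing h with
  | zero => exact measurable_const
  | succ n ih =>
    simp only [historyLaw, PMF.map, PMF.bind_apply]
    refine Measurable.tsum fun h' => (ih h').mul ?_
    refine Measurable.tsum fun π => Measurable.const_mul ?_ _
    refine Measurable.tsum fun x => Measurable.const_mul ?_ _
    exact Measurable.tsum fun e => (measurable_rollout_apply π 0 x e).mul_const _

/-- `historyLaw` as a Markov kernel from MDPs to histories. -/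
def historyKernel (ag : Agent H X A) (ρ : PMF X) (n : ℕ) :
    Kernel (MDP H X A) (History H X A) where
  toFun M := (ag.historyLaw ρ M n).toMeasure
  measurable' := by
    refine Measure.measurable_of_measurable_coe _ fun s hs => ?_
    simp only [PMF.toMeasure_apply _ hs]
    refine Measurable.tsum fun h => ?_
    by_cases hh : h ∈ s
    · simpa [Set.indicator, hh] using ag.measurable_historyLaw_apply ρ n h
    · simp [Set.indicator, hh]

/-- The independent Dirichlet prior over MDPs. -/
def prior (α : Triple H X A → Outcome X → ℝ) : Measure (MDP H X A) :=
  Measure.pi fun y => dirichlet (α y)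

/-- The joint law of the MDP `M`, of the history of the first `n` episodes of RLSVI in `M`, and of
the standardized noise that RLSVI draws in the next episode. -/
def jointLaw (ag : Agent H X A) (ρ : PMF X) (α : Triple H X A → Outcome X → ℝ) (n : ℕ) :
    Measure ((MDP H X A × History H X A) × (Triple H X A → ℝ)) :=
  (prior α ⊗ₘ ag.historyKernel ρ n).prod (noise H X A)

instance (ag : Agent H X A) (ρ : PMF X) (n : ℕ) : IsMarkovKernel (ag.historyKernel ρ n) :=
  ⟨fun M => PMF.toMeasure.isProbabilityMeasure (ag.historyLaw ρ M n)⟩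

theorem isProbabilityMeasure_jointLaw [Nonempty X] (ag : Agent H X A) (ρ : PMF X)
    (α : Triple H X A → Outcome X → ℝ) (hα : ∀ y o, 0 < α y o) (n : ℕ) :
    IsProbabilityMeasure (ag.jointLaw ρ α n) := by
  have := fun y => isProbabilityMeasure_dirichlet (α y) (hα y)
  unfold jointLaw prior
  infer_instance

end Agent

end

end RLSVI

/-!
Why the sampled value functions are stochastically optimistic.

*The posterior.* The probability of a history depends on the MDP only through the likelihood of the
recorded outcomes (`exists_historyLaw_eq_mul_likelihood`). By conjugacy of the Dirichlet family
(`dirichlet_withDensity`), given the history the MDP follows again a product of Dirichlet laws, with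
the outcome counts added to the parameters, and is independent of the fresh Gaussian noise
(`map_cond_jointLaw`).

*One triple.* Let `V` be a function of the outcome with values in `[0, B]`, and let `p` be a
Dirichlet vector whose parameters have sum `N`. Then `p · V` is dominated by a Gaussian with at
least the same mean and with variance at least `B² / N`
(`integral_dirichlet_le_integral_gaussianReal`). Reveal a sample from `p` one outcome at a time, as
in a Pólya urn. Each revealed outcome moves the conditional mean of `p · V` by a centred amount
whose values lie in an interval of length `B / (N + 1)`. Such an amount is dominated by a centred Gaussian
of variance `B² / (N (N + 1)) = B² / N - B² / (N + 1)` (`sum_le_integral_gaussianReal`), by the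
inequality `Φ (1 - Φ) ≤ Φ'` for the Gaussian distribution function
(`cdf_mul_one_sub_cdf_le_gaussianPDFReal`). The variances add up to `B² / N`, while the conditional
variance of `p · V` tends to zero. With `v / λ = β`, `v ≥ H²` and `θ̄ ≥ H`, the randomized backup at
a triple is such a Gaussian for the posterior of that triple, with `B = H`.

*All triples.* The domination has to be propagated for functions of all the action values of a
period at once, because the values of a period share those of the next one. The induction therefore
runs over all coordinatewise nondecreasing convex functions of the table `Q_t(·, ·)`
(`integral_recQ_le`). Given the table of period `t + 1`, the backups of period `t` are independent
over triples, so that they can be exchanged one at a time (`integral_pi_le_integral_pi`). The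
randomized Bellman operator is nondecreasing, convex and nonexpansive, hence it maps test functions
to test functions.

Test functions are taken Lipschitz, so that all integrals converge. This is no restriction, since
`Q*` is bounded by `H` and a convex nondecreasing function can be replaced by a support line beyond
`H` (`exists_lipschitz_minorant`).
-/

namespace RLSVI

noncomputable section

/-! ### Convex functions on the real line -/

theorem exists_subgradient {φ : ℝ → ℝ} (hφ : ConvexOn ℝ Set.univ φ) (x : ℝ) :
    ∃ s, ∀ y, φ x + s * (y - x) ≤ φ y := by
  refine ⟨derivWithin φ (Set.Ioi x) x, fun y => ?_⟩
  have hx : x ∈ interior (Set.univ : Set ℝ) := by simp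
  rcases lt_trichotomy x y with h | rfl | h
  · have := hφ.rightDeriv_le_slope_of_mem_interior hx (Set.mem_univ y) h
    rw [slope_def_field, le_div_iff₀ (by linarith)] at this
    linarith
  · simp
  · have := (hφ.slope_le_leftDeriv_of_mem_interior (Set.mem_univ y) hx h).trans
      (hφ.leftDeriv_le_rightDeriv_of_mem_interior hx)
    rw [slope_def_field, div_le_iff₀ (by linarith)] at this
    linarith

theorem convexOn_of_exists_subgradient {φ : ℝ → ℝ}
    (h : ∀ x, ∃ s, ∀ y, φ x + s * (y - x) ≤ φ y) : ConvexOn ℝ Set.univ φ := by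
  refine ⟨convex_univ, fun x _ y _ a b ha hb hab => ?_⟩
  obtain ⟨s, hs⟩ := h (a • x + b • y)
  have h1 := mul_le_mul_of_nonneg_left (hs x) ha
  have h2 := mul_le_mul_of_nonneg_left (hs y) hb
  simp only [smul_eq_mul] at *
  obtain rfl : b = 1 - a := by linarith
  nlinarith

/-- A convex nondecreasing function agrees on `(-∞, B]` with a Lipschitz convex nondecreasing
function that lies below it: replace it on `[B, ∞)` by a support line at `B`. -/
theorem exists_lipschitz_minorant {u : ℝ → ℝ} (hu : ConvexOn ℝ Set.univ u) (hm : Monotone u)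
    (B : ℝ) : ∃ v : ℝ → ℝ, ConvexOn ℝ Set.univ v ∧ Monotone v ∧ (∃ C, LipschitzWith C v) ∧
      (∀ x ≤ B, v x = u x) ∧ ∀ x, v x ≤ u x := by
  obtain ⟨l, hl⟩ := exists_subgradient hu B
  set v : ℝ → ℝ := fun x => if x ≤ B then u x else u B + l * (x - B) with hv
  have hl0 : 0 ≤ l := by
    have h1 := hl (B - 1)
    have h2 := hm (show B - 1 ≤ B by linarith)
    linarith
  have hle : ∀ x ≤ B, v x = u x := fun x hx => if_pos hx
  have hgt : ∀ x, B < x → v x = u B + l * (x - B) := fun x hx => if_neg (not_le.2 hx)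
  have key : ∀ x, ∃ s, 0 ≤ s ∧ s ≤ l ∧ ∀ y, v x + s * (y - x) ≤ v y := by
    intro x
    rcases lt_or_ge x B with hx | hx
    · obtain ⟨s, hs⟩ := exists_subgradient hu x
      have hsl : s ≤ l := by
        have h1 := hs B
        have h2 := hl x
        nlinarith
      refine ⟨s, ?_, hsl, fun y => ?_⟩
      · have h1 := hs (x - 1)
        have h2 := hm (show x - 1 ≤ x by linarith)
        linarith
      · rw [hle x hx.le]
        rcases le_or_gt y B with hy | hy
        · rw [hle y hy]; exact hs y
        · rw [hgt y hy]
          have h1 := hs B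
          nlinarith
    · refine ⟨l, hl0, le_rfl, fun y => ?_⟩
      have hvx : v x = u B + l * (x - B) := by
        rcases hx.eq_or_lt with rfl | hx
        · rw [hle _ le_rfl]; ring
        · exact hgt x hx
      rw [hvx]
      rcases le_or_gt y B with hy | hy
      · rw [hle y hy]
        have := hl y
        linarith
      · rw [hgt y hy]
        linarith
  have hmono : Monotone v := by
    intro x y hxy
    obtain ⟨s, hs0, -, hs⟩ := key x
    have := hs y
    nlinarith
  refine ⟨v, convexOn_of_exists_subgradient fun x => ?_, hmono, ⟨l.toNNReal, ?_⟩, hle,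
    fun x => ?_⟩
  · obtain ⟨s, -, -, hs⟩ := key x
    exact ⟨s, hs⟩
  · refine LipschitzWith.of_le_add_mul _ fun x y => ?_
    rw [Real.coe_toNNReal l hl0, Real.dist_eq]
    obtain ⟨s, hs0, hsl, hs⟩ := key x
    have h1 := hs y
    have h2 : s * (x - y) ≤ l * |x - y| :=
      (mul_le_mul_of_nonneg_left (le_abs_self _) hs0).trans
        (mul_le_mul_of_nonneg_right hsl (abs_nonneg _))
    linarith
  · rcases le_or_gt x B with hx | hx
    · exact (hle x hx).le
    · rw [hgt x hx]; exact hl x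

theorem lipschitzWith_comp_affine {φ : ℝ → ℝ} {C : NNReal} (hL : LipschitzWith C φ) (b k : ℝ) :
    LipschitzWith (C * ‖k‖₊) fun x => φ (b + k * x) := by
  refine hL.comp (LipschitzWith.of_dist_le_mul fun x y => ?_)
  rw [dist_add_left, Real.dist_eq, Real.dist_eq, ← mul_sub, abs_mul]
  rfl

theorem lipschitzWith_integral {Ω E : Type*} [MeasurableSpace Ω] [PseudoMetricSpace E]
    {μ : Measure Ω} [IsProbabilityMeasure μ] {f : E → Ω → ℝ} {C : NNReal}
    (hi : ∀ x, Integrable (f x) μ) (hf : ∀ ω, LipschitzWith C fun x => f x ω) :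
    LipschitzWith C fun x => ∫ ω, f x ω ∂μ := by
  refine LipschitzWith.of_dist_le_mul fun x x' => ?_
  rw [Real.dist_eq, ← integral_sub (hi _) (hi _)]
  have h : ∀ ω, ‖f x ω - f x' ω‖ ≤ C * dist x x' := fun ω => (hf ω).dist_le_mul x x'
  simpa using norm_integral_le_of_norm_le_const (μ := μ) (ae_of_all _ h)

/-! ### Finite products of probability measures -/

section Pi

variable {ι : Type*} [Fintype ι] {E : ι → Type*} [∀ i, MeasurableSpace (E i)]

/-- Resampling one coordinate of a product measure from a new law. -/
theorem map_update_pi [DecidableEq ι] (μ : ∀ i, Measure (E i)) [∀ i, IsProbabilityMeasure (μ i)]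
    (i : ι) (ν : Measure (E i)) [IsProbabilityMeasure ν] :
    ((Measure.pi μ).prod ν).map (fun p => Function.update p.1 i p.2) =
      Measure.pi (Function.update μ i ν) := by
  have hinst : ∀ j, IsProbabilityMeasure (Function.update μ i ν j) := by
    intro j
    rcases eq_or_ne j i with rfl | hj
    · simpa
    · simpa [hj] using inferInstanceAs (IsProbabilityMeasure (μ j))
  have hmeas : Measurable fun p : (∀ j, E j) × E i => Function.update p.1 i p.2 :=
    measurable_update'.comp measurable_id
  symm
  refine Measure.pi_eq fun s hs => ?_
  rw [Measure.map_apply hmeas (MeasurableSet.univ_pi hs)]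
  have : (fun p : (∀ j, E j) × E i => Function.update p.1 i p.2) ⁻¹' Set.univ.pi s =
      (Set.univ.pi (Function.update s i Set.univ)) ×ˢ s i := by
    ext ⟨x, y⟩
    simp only [Set.mem_preimage, Set.mem_univ_pi, Set.mem_prod]
    constructor
    · intro h
      refine ⟨fun j => ?_, by simpa using h i⟩
      rcases eq_or_ne j i with rfl | hj
      · simp
      · simpa [hj] using h j
    · rintro ⟨h1, h2⟩ j
      rcases eq_or_ne j i with rfl | hj
      · simpa using h2
      · simpa [hj] using h1 j
  rw [this, Measure.prod_prod, Measure.pi_pi, ← Finset.mul_prod_erase _ _ (Finset.mem_univ i),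
    ← Finset.mul_prod_erase _ (fun j => (Function.update μ i ν j) (s j)) (Finset.mem_univ i)]
  simp only [Function.update_self, measure_univ, one_mul]
  rw [mul_comm]
  congr 1
  refine Finset.prod_congr rfl fun j hj => ?_
  simp [Finset.ne_of_mem_erase hj]

/-- Resampling a set of coordinates of a product measure leaves it invariant. -/
theorem measurePreserving_piecewise_pi (μ : ∀ i, Measure (E i)) [∀ i, IsProbabilityMeasure (μ i)]
    (q : ι → Prop) [DecidablePred q] :
    MeasurePreserving (fun p : (∀ j, E j) × (∀ j, E j) => fun i => if q i then p.2 i else p.1 i)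
      ((Measure.pi μ).prod (Measure.pi μ)) (Measure.pi μ) := by
  have hmeas : Measurable (fun p : (∀ j, E j) × (∀ j, E j) =>
      fun i => if q i then p.2 i else p.1 i) := by
    refine measurable_pi_lambda _ fun i => ?_
    by_cases hi : q i
    · simp only [hi, if_true]
      exact (measurable_pi_apply i).comp measurable_snd
    · simp only [hi, if_false]
      exact (measurable_pi_apply i).comp measurable_fst
  refine ⟨hmeas, ?_⟩
  symm
  refine Measure.pi_eq fun s hs => ?_
  rw [Measure.map_apply hmeas (MeasurableSet.univ_pi hs)]
  have : (fun p : (∀ j, E j) × (∀ j, E j) => fun i => if q i then p.2 i else p.1 i) ⁻¹'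
      Set.univ.pi s = (Set.univ.pi fun i => if q i then Set.univ else s i) ×ˢ
        (Set.univ.pi fun i => if q i then s i else Set.univ) := by
    ext ⟨x, y⟩
    simp only [Set.mem_preimage, Set.mem_univ_pi, Set.mem_prod]
    rw [← forall_and]
    refine forall_congr' fun i => ?_
    by_cases hi : q i <;> simp [hi]
  rw [this, Measure.prod_prod, Measure.pi_pi, Measure.pi_pi, ← Finset.prod_mul_distrib]
  refine Finset.prod_congr rfl fun i _ => ?_
  by_cases hi : q i <;> simp [hi]

theorem integral_piecewise_pi (μ : ∀ i, Measure (E i)) [∀ i, IsProbabilityMeasure (μ i)]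
    (q : ι → Prop) [DecidablePred q] {f : (∀ i, E i) → ℝ} (hf : Integrable f (Measure.pi μ)) :
    Integrable (fun x => ∫ y, f (fun i => if q i then y i else x i) ∂Measure.pi μ)
        (Measure.pi μ) ∧
      ∫ x, f x ∂Measure.pi μ =
        ∫ x, ∫ y, f (fun i => if q i then y i else x i) ∂Measure.pi μ ∂Measure.pi μ := by
  have hmp := measurePreserving_piecewise_pi μ q
  have h := (hmp.integrable_comp hf.aestronglyMeasurable).2 hf
  refine ⟨h.integral_prod_left, ?_⟩
  conv_lhs => rw [← hmp.map_eq, integral_map hmp.aemeasurable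
    (by rw [hmp.map_eq]; exact hf.aestronglyMeasurable)]
  exact integral_prod _ h

theorem pi_withDensity (μ : ∀ i, Measure (E i)) [∀ i, IsProbabilityMeasure (μ i)]
    (f : ∀ i, E i → ℝ≥0∞) (hf : ∀ i, Measurable (f i))
    [∀ i, SigmaFinite ((μ i).withDensity (f i))] :
    Measure.pi (fun i => (μ i).withDensity (f i)) =
      (Measure.pi μ).withDensity fun x => ∏ i, f i (x i) := by
  refine Measure.pi_eq fun s hs => ?_
  rw [withDensity_apply _ (MeasurableSet.univ_pi hs),
    ← lintegral_indicator (MeasurableSet.univ_pi hs)]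
  have h1 : ∀ x : ∀ i, E i, (Set.univ.pi s).indicator (fun x => ∏ i, f i (x i)) x =
      ∏ i, (s i).indicator (f i) (x i) := by
    intro x
    by_cases hx : x ∈ Set.univ.pi s
    · rw [Set.indicator_of_mem hx]
      exact Finset.prod_congr rfl fun i _ => (Set.indicator_of_mem (hx i trivial) _).symm
    · rw [Set.indicator_of_notMem hx]
      simp only [Set.mem_univ_pi, not_forall] at hx
      obtain ⟨i, hi⟩ := hx
      exact (Finset.prod_eq_zero (Finset.mem_univ i) (Set.indicator_of_notMem hi _)).symm
  simp_rw [h1]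
  have hm : ∀ i, Measurable ((s i).indicator (f i)) := fun i => (hf i).indicator (hs i)
  rw [lintegral_prod_eq_prod_lintegral_of_indepFun Finset.univ
    (fun i (x : ∀ i, E i) => (s i).indicator (f i) (x i))
    (iIndepFun_pi fun i => (hm i).aemeasurable) fun i => (hm i).comp (measurable_pi_apply i)]
  refine Finset.prod_congr rfl fun i _ => ?_
  rw [withDensity_apply _ (hs i), ← lintegral_indicator (hs i),
    ← (measurePreserving_eval μ i).lintegral_comp (hm i)]

/-- Reweighting a product measure by a function of one coordinate only changes the law of this
coordinate. -/
theorem lintegral_pi_mul_eval [DecidableEq ι] (μ : ∀ i, Measure (E i))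
    [∀ i, IsProbabilityMeasure (μ i)] (i : ι) {f : E i → ℝ≥0∞} (hf : Measurable f) {c : ℝ≥0∞}
    {ν : Measure (E i)} [IsProbabilityMeasure ν] (h : (μ i).withDensity f = c • ν)
    {G : (∀ i, E i) → ℝ≥0∞} (hG : Measurable G) :
    ∫⁻ x, f (x i) * G x ∂Measure.pi μ = c * ∫⁻ x, G x ∂Measure.pi (Function.update μ i ν) := by
  have hup : Measurable fun p : (∀ j, E j) × E i => Function.update p.1 i p.2 :=
    measurable_update'.comp measurable_id
  have e1 := map_update_pi μ i (μ i)
  have e2 := map_update_pi μ i ν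
  rw [Function.update_eq_self] at e1
  have m1 : Measurable fun x : ∀ i, E i => f (x i) * G x := by fun_prop
  have hG1 : Measurable fun p : (∀ j, E j) × E i =>
      f (Function.update p.1 i p.2 i) * G (Function.update p.1 i p.2) := m1.comp hup
  have hG2 : Measurable fun p : (∀ j, E j) × E i => G (Function.update p.1 i p.2) := hG.comp hup
  conv_lhs => rw [← e1, lintegral_map m1 hup, lintegral_prod _ hG1.aemeasurable]
  rw [← e2, lintegral_map hG hup, lintegral_prod _ hG2.aemeasurable,
    ← lintegral_const_mul _ hG2.lintegral_prod_right']
  refine lintegral_congr fun x => ?_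
  have m2 : Measurable fun y => G (Function.update x i y) := hG.comp (measurable_update x)
  simp only [Function.update_self]
  have := lintegral_withDensity_eq_lintegral_mul (μ i) hf m2
  rw [h, lintegral_smul_measure] at this
  exact this.symm

end Pi

section Coordinatewise

variable {ι : Type*} [Fintype ι]

theorem integrable_of_lipschitzWith_pi (μ : ι → Measure ℝ) [∀ i, IsProbabilityMeasure (μ i)]
    (hμ : ∀ i, Integrable (fun x => x) (μ i)) {U : (ι → ℝ) → ℝ} {C : NNReal}
    (hU : LipschitzWith C U) : Integrable U (Measure.pi μ) := by
  have hb : Integrable (fun x : ι → ℝ => |U 0| + C * ∑ i, |x i|) (Measure.pi μ) := by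
    refine (integrable_const _).add (Integrable.const_mul (integrable_finsetSum _ fun i _ => ?_) _)
    exact integrable_comp_eval (f := fun x => |x|) (hμ i).abs
  refine hb.mono' hU.continuous.aestronglyMeasurable (ae_of_all _ fun x => ?_)
  have h1 := hU.dist_le_mul x 0
  rw [Real.dist_eq, dist_zero_right] at h1
  have h2 : ‖x‖ ≤ ∑ i, |x i| :=
    (pi_norm_le_iff_of_nonneg (Finset.sum_nonneg fun i _ => abs_nonneg _)).2 fun i =>
      Finset.single_le_sum (f := fun i => |x i|) (fun i _ => abs_nonneg _) (Finset.mem_univ i)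
  have h3 : |U x| ≤ |U 0| + |U x - U 0| := by
    have := abs_add_le (U 0) (U x - U 0)
    rwa [add_sub_cancel] at this
  rw [Real.norm_eq_abs]
  have := mul_le_mul_of_nonneg_left h2 C.2
  simp only [NNReal.val_eq_coe] at this
  linarith

/-- For product measures, domination of each coordinate for convex nondecreasing test functions
implies domination for all coordinatewise nondecreasing convex functions: the coordinates are
exchanged one at a time, conditionally on the others. -/
theorem integral_pi_le_integral_pi [DecidableEq ι] (μ ν : ι → Measure ℝ)
    [∀ i, IsProbabilityMeasure (μ i)] [∀ i, IsProbabilityMeasure (ν i)]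
    (hμ : ∀ i, Integrable (fun x => x) (μ i)) (hν : ∀ i, Integrable (fun x => x) (ν i))
    (h : ∀ i, ∀ φ : ℝ → ℝ, ConvexOn ℝ Set.univ φ → Monotone φ → (∃ C, LipschitzWith C φ) →
      ∫ x, φ x ∂μ i ≤ ∫ x, φ x ∂ν i)
    {U : (ι → ℝ) → ℝ} (hc : ConvexOn ℝ Set.univ U) (hm : Monotone U) {C : NNReal}
    (hL : LipschitzWith C U) :
    ∫ x, U x ∂Measure.pi μ ≤ ∫ x, U x ∂Measure.pi ν := by
  have key : ∀ s : Finset ι,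
      ∫ x, U x ∂Measure.pi μ ≤ ∫ x, U x ∂Measure.pi fun i => if i ∈ s then ν i else μ i := by
    intro s
    induction s using Finset.induction_on with
    | empty => simp
    | insert i s hi ih =>
      refine ih.trans ?_
      set κ : ι → Measure ℝ := fun j => if j ∈ s then ν j else μ j with hκ
      have hκp : ∀ j, IsProbabilityMeasure (κ j) := by
        intro j
        simp only [hκ]
        split_ifs <;> infer_instance
      have hκi : ∀ j, Integrable (fun x => x) (κ j) := by
        intro j
        simp only [hκ]
        split_ifs
        exacts [hν j, hμ j]
      have hκ' : (fun j => if j ∈ insert i s then ν j else μ j) =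
          Function.update κ i (ν i) := by
        funext j
        rcases eq_or_ne j i with rfl | hj
        · simp
        · simp [hj, hκ]
      have hκκ : κ = Function.update κ i (μ i) := by
        rw [eq_comm, Function.update_eq_self_iff]
        simp [hκ, hi]
      have hup : Measurable fun p : (ι → ℝ) × ℝ => Function.update p.1 i p.2 :=
        measurable_update'.comp measurable_id
      -- integrals against a product measure with the `i`-th marginal replaced by `η`
      have fub : ∀ η : Measure ℝ, IsProbabilityMeasure η → Integrable (fun x => x) η →
          Integrable (fun x => ∫ y, U (Function.update x i y) ∂η) (Measure.pi κ) ∧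
          ∫ x, U x ∂Measure.pi (Function.update κ i η) =
            ∫ x, ∫ y, U (Function.update x i y) ∂η ∂Measure.pi κ := by
        intro η hη hηi
        have hup' : ∀ j, IsProbabilityMeasure (Function.update κ i η j) := by
          intro j
          rcases eq_or_ne j i with rfl | hj
          · simpa
          · simpa [hj] using hκp j
        have hint : Integrable U (Measure.pi (Function.update κ i η)) := by
          refine integrable_of_lipschitzWith_pi _ (fun j => ?_) hL
          rcases eq_or_ne j i with rfl | hj
          · simpa
          · simpa [hj] using hκi j
        rw [← map_update_pi κ i η] at hint ⊢
        rw [integrable_map_measure hL.continuous.aestronglyMeasurable hup.aemeasurable] at hint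
        rw [integral_map hup.aemeasurable hL.continuous.aestronglyMeasurable]
        exact ⟨hint.integral_prod_left, integral_prod _ hint⟩
      rw [hκ']
      conv_lhs => rw [hκκ]
      obtain ⟨i1, e1⟩ := fub (μ i) inferInstance (hμ i)
      obtain ⟨i2, e2⟩ := fub (ν i) inferInstance (hν i)
      rw [e1, e2]
      refine integral_mono i1 i2 fun x => h i _ ?_ ?_ ⟨C, ?_⟩
      · refine ⟨convex_univ, fun a _ b _ p q hp hq hpq => ?_⟩
        refine le_trans (le_of_eq (congrArg U ?_))
          (hc.2 (Set.mem_univ _) (Set.mem_univ _) hp hq hpq)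
        funext j
        rcases eq_or_ne j i with rfl | hj
        · simp
        · simp [hj, ← add_mul, hpq]
      · exact fun a b hab => hm (update_le_update_iff.2 ⟨hab, fun _ _ => le_rfl⟩)
      · refine LipschitzWith.of_dist_le_mul fun a b => (hL.dist_le_mul _ _).trans ?_
        refine mul_le_mul_of_nonneg_left ((dist_pi_le_iff dist_nonneg).2 fun j => ?_) C.2
        rcases eq_or_ne j i with rfl | hj
        · simp
        · simp [hj]
  simpa using key Finset.univ

end Coordinatewise

/-! ### Gaussian domination of bounded centred variables -/

section Gaussian

open Filter Topology

theorem gaussianPDFReal_zero_one (x : ℝ) :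
    gaussianPDFReal 0 1 x = (√(2 * Real.pi))⁻¹ * Real.exp (-x ^ 2 / 2) := by
  simp [gaussianPDFReal]

theorem gaussianPDFReal_zero_one_le (x : ℝ) : gaussianPDFReal 0 1 x ≤ 1 / 2 := by
  rw [gaussianPDFReal_zero_one]
  have h1 : 2 ≤ √(2 * Real.pi) := by
    refine Real.le_sqrt_of_sq_le ?_
    linarith [Real.pi_gt_three]
  have h2 : (√(2 * Real.pi))⁻¹ ≤ 1 / 2 := by
    rw [one_div]
    exact inv_anti₀ two_pos h1
  have h3 : Real.exp (-x ^ 2 / 2) ≤ 1 := Real.exp_le_one_iff.2 (by nlinarith [sq_nonneg x])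
  calc _ ≤ 1 / 2 * 1 := mul_le_mul h2 h3 (Real.exp_pos _).le (by norm_num)
    _ = 1 / 2 := mul_one _

theorem hasDerivAt_gaussianPDFReal_zero_one (x : ℝ) :
    HasDerivAt (gaussianPDFReal 0 1) (-x * gaussianPDFReal 0 1 x) x := by
  have : gaussianPDFReal 0 1 = fun x => (√(2 * Real.pi))⁻¹ * Real.exp (-x ^ 2 / 2) :=
    funext gaussianPDFReal_zero_one
  rw [this]
  have h := (((hasDerivAt_pow 2 x).neg.div_const 2).exp).const_mul (√(2 * Real.pi))⁻¹
  refine h.congr_deriv ?_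
  simp
  ring

theorem continuous_gaussianPDFReal_zero_one : Continuous (gaussianPDFReal 0 1) :=
  continuous_iff_continuousAt.2 fun x => (hasDerivAt_gaussianPDFReal_zero_one x).continuousAt

theorem cdf_gaussianReal_eq_integral (t : ℝ) :
    cdf (gaussianReal 0 1) t = ∫ x in Set.Iic t, gaussianPDFReal 0 1 x := by
  rw [cdf_eq_real, Measure.real, gaussianReal_apply_eq_integral _ one_ne_zero,
    ENNReal.toReal_ofReal]
  exact integral_nonneg fun x => gaussianPDFReal_nonneg _ _ _

theorem hasDerivAt_cdf_gaussianReal (t : ℝ) :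
    HasDerivAt (cdf (gaussianReal 0 1)) (gaussianPDFReal 0 1 t) t := by
  have h : ∀ s, cdf (gaussianReal 0 1) s =
      cdf (gaussianReal 0 1) 0 + ∫ x in (0 : ℝ)..s, gaussianPDFReal 0 1 x := by
    intro s
    rw [← intervalIntegral.integral_Iic_sub_Iic (integrable_gaussianPDFReal _ _).integrableOn
      (integrable_gaussianPDFReal _ _).integrableOn, cdf_gaussianReal_eq_integral,
      cdf_gaussianReal_eq_integral]
    ring
  have h' : (cdf (gaussianReal 0 1) : ℝ → ℝ) = _ := funext h
  rw [h']
  exact (continuous_gaussianPDFReal_zero_one.integral_hasStrictDerivAt 0 t).hasDerivAt.const_add _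

theorem cdf_gaussianReal_zero : cdf (gaussianReal 0 1) 0 = 1 / 2 := by
  have h1 : (gaussianReal 0 1).real (Set.Iic 0) = (gaussianReal 0 1).real (Set.Ioi 0) := by
    have hm : (gaussianReal 0 1).map (fun x => -x) = gaussianReal 0 1 := by
      rw [gaussianReal_map_neg, neg_zero]
    have : NullSingletonClass (gaussianReal 0 1) := nullSingletonClass_gaussianReal one_ne_zero
    rw [measureReal_def, measureReal_def, measure_congr Ioi_ae_eq_Ici]
    conv_rhs => rw [← hm]
    rw [Measure.map_apply measurable_neg measurableSet_Ici]
    congr 2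
    ext x
    simp
  have h2 := probReal_add_probReal_compl (μ := gaussianReal 0 1) (measurableSet_Iic (a := (0 : ℝ)))
  rw [Set.compl_Iic] at h2
  rw [cdf_eq_real]
  linarith

/-- The Gaussian isoperimetric profile dominates the parabola. The difference is nonnegative at
`±∞`, nondecreasing on `(-∞, 0]` and nonincreasing on `[0, ∞)`, because the density is at
most `1 / 2`. -/
theorem cdf_mul_one_sub_cdf_le_gaussianPDFReal (t : ℝ) :
    cdf (gaussianReal 0 1) t * (1 - cdf (gaussianReal 0 1) t) ≤ gaussianPDFReal 0 1 t := by
  set F : ℝ → ℝ := ⇑(cdf (gaussianReal 0 1)) with hF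
  set g := gaussianPDFReal 0 1 with hg
  have hFd : ∀ t, HasDerivAt F (g t) t := hasDerivAt_cdf_gaussianReal
  have hF0 : F 0 = 1 / 2 := cdf_gaussianReal_zero
  have hgap : Antitone fun t => F t - t / 2 := by
    refine antitone_of_hasDerivAt_nonpos (f' := fun t => g t - 1 / 2)
      (fun t => ((hFd t).sub ((hasDerivAt_id t).div_const 2))) fun t => ?_
    have := gaussianPDFReal_zero_one_le t
    simp only [Pi.zero_apply]
    linarith
  set D : ℝ → ℝ := fun t => g t - F t * (1 - F t) with hD
  have hDd : ∀ t, HasDerivAt D (g t * (2 * F t - 1 - t)) t := by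
    intro t
    refine ((hasDerivAt_gaussianPDFReal_zero_one t).sub
      ((hFd t).mul ((hFd t).const_sub 1))).congr_deriv ?_
    ring
  have hDc : Continuous D := continuous_iff_continuousAt.2 fun t => (hDd t).continuousAt
  have hg0 : ∀ t, 0 ≤ g t := fun t => gaussianPDFReal_nonneg _ _ _
  suffices h : 0 ≤ D t by simp only [hD] at h; linarith
  have hlow : ∀ s, -(F s * (1 - F s)) ≤ D s := fun s => by
    have := hg0 s
    simp only [hD]
    linarith
  rcases le_total 0 t with ht | ht
  · have hanti : AntitoneOn D (Set.Ici 0) := by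
      refine antitoneOn_of_deriv_nonpos (convex_Ici 0) hDc.continuousOn
        (fun x _ => (hDd x).differentiableAt.differentiableWithinAt) fun x hx => ?_
      rw [interior_Ici, Set.mem_Ioi] at hx
      rw [(hDd x).deriv]
      have := hgap hx.le
      simp only [hF0] at this
      exact mul_nonpos_of_nonneg_of_nonpos (hg0 x) (by linarith)
    have hlim : Tendsto (fun s => -(F s * (1 - F s))) atTop (𝓝 0) := by
      have h := tendsto_cdf_atTop (gaussianReal 0 1)
      simpa using (h.mul (h.const_sub 1)).neg
    refine le_of_tendsto hlim ?_
    filter_upwards [eventually_ge_atTop t] with s hs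
    exact (hlow s).trans (hanti (Set.mem_Ici.2 ht) (Set.mem_Ici.2 (ht.trans hs)) hs)
  · have hmono : MonotoneOn D (Set.Iic 0) := by
      refine monotoneOn_of_deriv_nonneg (convex_Iic 0) hDc.continuousOn
        (fun x _ => (hDd x).differentiableAt.differentiableWithinAt) fun x hx => ?_
      rw [interior_Iic, Set.mem_Iio] at hx
      rw [(hDd x).deriv]
      have := hgap hx.le
      simp only [hF0] at this
      exact mul_nonneg (hg0 x) (by linarith)
    have hlim : Tendsto (fun s => -(F s * (1 - F s))) atBot (𝓝 0) := by
      have h := tendsto_cdf_atBot (gaussianReal 0 1)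
      simpa using (h.mul (h.const_sub 1)).neg
    refine le_of_tendsto hlim ?_
    filter_upwards [eventually_le_atBot t] with s hs
    exact (hlow s).trans (hmono (Set.mem_Iic.2 (hs.trans ht)) (Set.mem_Iic.2 ht) hs)

theorem integrable_id_gaussianReal (m : ℝ) (v : NNReal) :
    Integrable (fun x => x) (gaussianReal m v) :=
  (memLp_id_gaussianReal (μ := m) (v := v) 1).integrable le_rfl

theorem integrable_gaussianReal_of_lipschitzWith {φ : ℝ → ℝ} {C : NNReal}
    (hφ : LipschitzWith C φ) (m : ℝ) (v : NNReal) : Integrable φ (gaussianReal m v) := by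
  have hb : Integrable (fun x : ℝ => |φ 0| + C * |x|) (gaussianReal m v) :=
    (integrable_const _).add ((integrable_id_gaussianReal m v).abs.const_mul _)
  refine hb.mono' hφ.continuous.aestronglyMeasurable (ae_of_all _ fun x => ?_)
  have h1 := hφ.dist_le_mul x 0
  rw [Real.dist_eq, Real.dist_eq, sub_zero] at h1
  have h3 := abs_add_le (φ 0) (φ x - φ 0)
  rw [add_sub_cancel] at h3
  rw [Real.norm_eq_abs]
  linarith

theorem setIntegral_Iic_id_gaussianReal (t : ℝ) :
    ∫ x in Set.Iic t, x ∂gaussianReal 0 1 = -gaussianPDFReal 0 1 t := by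
  have hint : Integrable fun x : ℝ => -x * gaussianPDFReal 0 1 x := by
    have h := (integrable_mul_exp_neg_mul_sq (b := 1 / 2) (by norm_num)).const_mul
      (-(√(2 * Real.pi))⁻¹)
    refine h.congr (ae_of_all _ fun x => ?_)
    simp only [gaussianPDFReal_zero_one]
    rw [show -(1 / 2) * x ^ 2 = -x ^ 2 / 2 by ring]
    ring
  have hlim : Tendsto (gaussianPDFReal 0 1) atBot (𝓝 0) := by
    rw [show gaussianPDFReal 0 1 = fun x => (√(2 * Real.pi))⁻¹ * Real.exp (-x ^ 2 / 2) from
      funext gaussianPDFReal_zero_one, ← mul_zero (√(2 * Real.pi))⁻¹]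
    refine (Real.tendsto_exp_atBot.comp ?_).const_mul _
    have h : Tendsto (fun x : ℝ => x ^ 2) atBot atTop := by
      exact ((tendsto_pow_atTop (α := ℝ) two_ne_zero).comp tendsto_abs_atBot_atTop).congr
        fun x => sq_abs x
    have h2 := (h.const_mul_atTop (show (0 : ℝ) < 1 / 2 by norm_num))
    refine (tendsto_neg_atTop_atBot.comp h2).congr fun x => ?_
    simp only [Function.comp_apply]
    ring
  have h := integral_Iic_of_hasDerivAt_of_tendsto' (a := t)
    (fun x _ => hasDerivAt_gaussianPDFReal_zero_one x) hint.integrableOn hlim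
  rw [gaussianReal_of_var_ne_zero _ one_ne_zero,
    setIntegral_withDensity_eq_setIntegral_toReal_smul (measurable_gaussianPDF _ _)
      (ae_of_all _ fun _ => gaussianPDF_lt_top) _ measurableSet_Iic]
  simp only [toReal_gaussianPDF, smul_eq_mul]
  rw [sub_zero] at h
  rw [← h, ← integral_neg]
  exact integral_congr_ae (ae_of_all _ fun x => by ring)

/-- The centred two-point law on `{-p, 1 - p}` is dominated by the standard Gaussian in the convex
order: bound `φ` from below by its support lines at `-p` and `1 - p` on the two sides of the
`(1 - p)`-quantile. -/
theorem two_point_le_integral_gaussianReal {φ : ℝ → ℝ} (hφ : ConvexOn ℝ Set.univ φ) {C : NNReal}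
    (hL : LipschitzWith C φ) {p : ℝ} (hp0 : 0 ≤ p) (hp1 : p ≤ 1) :
    p * φ (1 - p) + (1 - p) * φ (-p) ≤ ∫ x, φ x ∂gaussianReal 0 1 := by
  have hφi := integrable_gaussianReal_of_lipschitzWith hL 0 1
  have hid := integrable_id_gaussianReal 0 1
  have hmean : ∫ x, x ∂gaussianReal 0 1 = 0 := integral_id_gaussianReal
  -- Jensen's inequality, for the degenerate cases
  have hJ : φ 0 ≤ ∫ x, φ x ∂gaussianReal 0 1 := by
    obtain ⟨s, hs⟩ := exists_subgradient hφ 0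
    have := integral_mono (μ := gaussianReal 0 1) ((integrable_const (φ 0)).add (hid.const_mul s))
      hφi fun x => by simpa using hs x
    simp only [Pi.add_apply] at this
    rw [integral_add (integrable_const _) (hid.const_mul s), integral_const_mul, hmean] at this
    simpa using this
  rcases hp0.eq_or_lt with rfl | hp0
  · simpa using hJ
  rcases hp1.eq_or_lt with rfl | hp1
  · simpa using hJ
  obtain ⟨t, ht⟩ : ∃ t, cdf (gaussianReal 0 1) t = 1 - p := by
    have hc : Continuous (cdf (gaussianReal 0 1) : ℝ → ℝ) :=
      continuous_iff_continuousAt.2 fun t => (hasDerivAt_cdf_gaussianReal t).continuousAt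
    have h0 := ((tendsto_cdf_atBot (gaussianReal 0 1)).eventually
      (eventually_le_nhds (show 0 < 1 - p by linarith))).exists
    have h1 := ((tendsto_cdf_atTop (gaussianReal 0 1)).eventually
      (eventually_ge_nhds (show 1 - p < 1 by linarith))).exists
    exact mem_range_of_exists_le_of_exists_ge hc h0 h1
  have hpdf := cdf_mul_one_sub_cdf_le_gaussianPDFReal t
  rw [ht] at hpdf
  obtain ⟨s1, hs1⟩ := exists_subgradient hφ (1 - p)
  obtain ⟨s0, hs0⟩ := exists_subgradient hφ (-p)
  have hs : s0 ≤ s1 := by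
    have h1 := hs1 (-p)
    have h2 := hs0 (1 - p)
    nlinarith
  have hlow : (gaussianReal 0 1).real (Set.Iic t) = 1 - p := by rw [← cdf_eq_real, ht]
  have hup : (gaussianReal 0 1).real (Set.Ioi t) = p := by
    have h2 := probReal_add_probReal_compl (μ := gaussianReal 0 1) (measurableSet_Iic (a := t))
    rw [Set.compl_Iic] at h2
    linarith
  have hmlow := setIntegral_Iic_id_gaussianReal t
  have hmup : ∫ x in Set.Ioi t, x ∂gaussianReal 0 1 = gaussianPDFReal 0 1 t := by
    have h2 := integral_add_compl (measurableSet_Iic (a := t)) hid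
    rw [Set.compl_Iic, hmean] at h2
    linarith
  have hline : ∀ (S : Set ℝ) (c s b : ℝ), (∀ y, c + s * (y - b) ≤ φ y) → MeasurableSet S →
      (c - s * b) * (gaussianReal 0 1).real S + s * ∫ x in S, x ∂gaussianReal 0 1 ≤
        ∫ x in S, φ x ∂gaussianReal 0 1 := by
    intro S c s b h hS
    have := setIntegral_mono (s := S) (μ := gaussianReal 0 1)
      ((integrable_const (c - s * b)).add (hid.const_mul s)).integrableOn
      hφi.integrableOn fun x => by
        have := h x
        simp only [Pi.add_apply]
        linarith
    simp only [Pi.add_apply] at this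
    rw [integral_add (integrable_const _).integrableOn (hid.const_mul s).integrableOn,
      integral_const_mul, setIntegral_const, smul_eq_mul] at this
    linarith
  have e0 := hline _ _ _ _ hs0 (measurableSet_Iic (a := t))
  have e1 := hline _ _ _ _ hs1 (measurableSet_Ioi (a := t))
  have e2 := integral_add_compl (measurableSet_Iic (a := t)) hφi
  rw [Set.compl_Iic] at e2
  rw [hlow, hmlow] at e0
  rw [hup, hmup] at e1
  rw [← e2]
  nlinarith

/-- A centred finitely supported variable whose values lie in an interval of length `s` is dominated
by `N(0, s²)` in the convex order. -/
theorem sum_le_integral_gaussianReal {ι : Type*} [Fintype ι] {w X : ι → ℝ} (hw : ∀ i, 0 ≤ w i)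
    (hw1 : ∑ i, w i = 1) (hX : ∑ i, w i * X i = 0) {a s : ℝ} (hs : 0 < s) (ha : ∀ i, a ≤ X i)
    (hb : ∀ i, X i ≤ a + s) {φ : ℝ → ℝ} (hφ : ConvexOn ℝ Set.univ φ) {C : NNReal}
    (hL : LipschitzWith C φ) :
    ∑ i, w i * φ (X i) ≤ ∫ x, φ (s * x) ∂gaussianReal 0 1 := by
  have ha0 : a ≤ 0 := by
    have : ∑ i, w i * a ≤ ∑ i, w i * X i :=
      Finset.sum_le_sum fun i _ => mul_le_mul_of_nonneg_left (ha i) (hw i)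
    rwa [← Finset.sum_mul, hw1, hX, one_mul] at this
  have hb0 : 0 ≤ a + s := by
    have : ∑ i, w i * X i ≤ ∑ i, w i * (a + s) :=
      Finset.sum_le_sum fun i _ => mul_le_mul_of_nonneg_left (hb i) (hw i)
    rwa [← Finset.sum_mul, hw1, hX, one_mul] at this
  set p := -a / s with hp
  have hsp : s * p = -a := by rw [hp]; field_simp
  have hchord : ∀ i, φ (X i) ≤ (X i - a) / s * φ (a + s) + (1 - (X i - a) / s) * φ a := by
    intro i
    have h := hφ.2 (Set.mem_univ (a + s)) (Set.mem_univ a)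
      (div_nonneg (sub_nonneg.2 (ha i)) hs.le)
      (show 0 ≤ 1 - (X i - a) / s by
        rw [sub_nonneg, div_le_one hs]; linarith [hb i]) (by ring)
    have e : (X i - a) / s * (a + s) + (1 - (X i - a) / s) * a = X i := by
      field_simp
      ring
    simp only [smul_eq_mul, e] at h
    exact h
  have hsum : ∑ i, w i * φ (X i) ≤ p * φ (a + s) + (1 - p) * φ a := by
    refine (Finset.sum_le_sum fun i _ => mul_le_mul_of_nonneg_left (hchord i) (hw i)).trans_eq ?_
    have : ∀ i, w i * ((X i - a) / s * φ (a + s) + (1 - (X i - a) / s) * φ a) =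
        w i * X i * ((φ (a + s) - φ a) / s) + w i * (φ a - a / s * (φ (a + s) - φ a)) := by
      intro i
      ring
    simp_rw [this]
    rw [Finset.sum_add_distrib, ← Finset.sum_mul, ← Finset.sum_mul, hX, hw1, hp]
    ring
  refine hsum.trans ?_
  have hφs : ConvexOn ℝ Set.univ fun x => φ (s * x) := by
    refine ⟨convex_univ, fun x _ y _ α β hα hβ hαβ => ?_⟩
    refine le_trans (le_of_eq (congrArg φ ?_)) (hφ.2 (Set.mem_univ _) (Set.mem_univ _) hα hβ hαβ)
    simp only [smul_eq_mul]
    ring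
  have hLs : LipschitzWith (C * s.toNNReal) fun x => φ (s * x) := by
    refine hL.comp (LipschitzWith.of_dist_le_mul fun x y => ?_)
    rw [Real.coe_toNNReal s hs.le, Real.dist_eq, Real.dist_eq, ← mul_sub, abs_mul, abs_of_pos hs]
  have := two_point_le_integral_gaussianReal hφs hLs (p := p) (div_nonneg (by linarith) hs.le)
    ((div_le_one hs).2 (by linarith))
  have e1 : s * (1 - p) = a + s := by rw [mul_sub, hsp]; ring
  have e2 : s * -p = a := by rw [mul_neg, hsp]; ring
  simpa only [e1, e2] using this

/-- The sum of independent centred Gaussians. -/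
theorem integral_gaussianReal_add {φ : ℝ → ℝ} {C : NNReal} (hL : LipschitzWith C φ) (m c d e : ℝ)
    (h : c ^ 2 + d ^ 2 = e ^ 2) :
    ∫ x, ∫ y, φ (m + c * x + d * y) ∂gaussianReal 0 1 ∂gaussianReal 0 1 =
      ∫ x, φ (m + e * x) ∂gaussianReal 0 1 := by
  have hm : ∀ k : ℝ, (gaussianReal 0 1).map (k * ·) =
      gaussianReal 0 (.mk (k ^ 2) (sq_nonneg _)) := by
    intro k
    rw [gaussianReal_map_const_mul, mul_zero, mul_one]
  have hφm : Continuous fun x => φ (m + x) := by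
    have := hL.continuous
    fun_prop
  have hmap : ∀ (k b : ℝ), ∫ y, φ (b + k * y) ∂gaussianReal 0 1 =
      ∫ y, φ (b + y) ∂gaussianReal 0 (.mk (k ^ 2) (sq_nonneg _)) := by
    intro k b
    have := hL.continuous
    rw [← hm, integral_map (by fun_prop) (by fun_prop)]
  simp_rw [hmap d, hmap e]
  have hc1 : Continuous fun x =>
      ∫ y, φ (m + x + y) ∂gaussianReal 0 (.mk (d ^ 2) (sq_nonneg _)) := by
    refine (lipschitzWith_integral (C := C * ‖(1 : ℝ)‖₊) (fun x => ?_) fun y => ?_).continuous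
    · simpa using integrable_gaussianReal_of_lipschitzWith
        (lipschitzWith_comp_affine hL (m + x) 1) 0 (.mk (d ^ 2) (sq_nonneg _))
    · simpa [add_right_comm] using lipschitzWith_comp_affine hL (m + y) 1
  have hconv : gaussianReal 0 (.mk (e ^ 2) (sq_nonneg _)) =
      (gaussianReal 0 (.mk (c ^ 2) (sq_nonneg _))).conv
        (gaussianReal 0 (.mk (d ^ 2) (sq_nonneg _))) := by
    rw [gaussianReal_conv_gaussianReal, add_zero]
    congr 1
    ext
    exact h.symm
  rw [hconv, Measure.conv, integral_map (by fun_prop) hφm.aestronglyMeasurable, integral_prod]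
  · simp only [← add_assoc]
    rw [← hm c, integral_map (by fun_prop) hc1.aestronglyMeasurable]
  · have := integrable_gaussianReal_of_lipschitzWith (lipschitzWith_comp_affine hL m 1) 0
      (.mk (e ^ 2) (sq_nonneg _))
    simp only [one_mul] at this
    rw [hconv, Measure.conv,
      integrable_map_measure hφm.aestronglyMeasurable (by fun_prop)] at this
    exact this

/-- Increasing the variance or the mean of a Gaussian increases its expectations of convex
nondecreasing functions. -/
theorem integral_gaussianReal_mono {φ : ℝ → ℝ} (hφ : ConvexOn ℝ Set.univ φ) (hmono : Monotone φ)
    {C : NNReal} (hL : LipschitzWith C φ) {m m' c c' : ℝ} (hm : m ≤ m') (hc : c ^ 2 ≤ c' ^ 2) :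
    ∫ x, φ (m + c * x) ∂gaussianReal 0 1 ≤ ∫ x, φ (m' + c' * x) ∂gaussianReal 0 1 := by
  have hLk : ∀ (b k : ℝ), Integrable (fun x => φ (b + k * x)) (gaussianReal 0 1) := by
    intro b k
    exact integrable_gaussianReal_of_lipschitzWith (lipschitzWith_comp_affine hL b k) _ _
  refine (integral_mono (hLk m c) (hLk m' c) fun x => hmono (by linarith)).trans ?_
  set d := √(c' ^ 2 - c ^ 2)
  have hd : c ^ 2 + d ^ 2 = c' ^ 2 := by
    rw [Real.sq_sqrt (by linarith)]
    ring
  rw [← integral_gaussianReal_add hL m' c d c' hd]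
  have hint : Integrable (fun x => ∫ y, φ (m' + c * x + d * y) ∂gaussianReal 0 1)
      (gaussianReal 0 1) := by
    refine integrable_gaussianReal_of_lipschitzWith (C := C * ‖c‖₊)
      (lipschitzWith_integral (fun x => hLk _ d) fun y => ?_) _ _
    simpa [add_right_comm] using lipschitzWith_comp_affine hL (m' + d * y) c
  refine integral_mono (hLk m' c) hint fun x => ?_
  obtain ⟨s, hs⟩ := exists_subgradient hφ (m' + c * x)
  have := integral_mono (μ := gaussianReal 0 1) ((integrable_const (φ (m' + c * x))).add
    ((integrable_id_gaussianReal 0 1).const_mul (s * d))) (hLk (m' + c * x) d) fun y => by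
      have := hs (m' + c * x + d * y)
      simp only [Pi.add_apply]
      linarith
  simp only [Pi.add_apply] at this
  rw [integral_add (integrable_const _) ((integrable_id_gaussianReal 0 1).const_mul _),
    integral_const_mul, integral_id_gaussianReal] at this
  simpa using this

end Gaussian

/-! ### Conjugacy of the Dirichlet distribution -/

section Dirichlet

theorem gammaMeasure_withDensity_id {a : ℝ} (ha : 0 < a) :
    (gammaMeasure a 1).withDensity ENNReal.ofReal = ENNReal.ofReal a • gammaMeasure (a + 1) 1 := by
  have hpdf : ∀ b, Measurable (gammaPDF b 1) := fun b =>
    (measurable_gammaPDFReal b 1).ennreal_ofReal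
  rw [gammaMeasure, gammaMeasure, ← withDensity_mul _ (hpdf a) ENNReal.measurable_ofReal,
    ← withDensity_smul _ (hpdf (a + 1))]
  congr 1
  funext x
  simp only [Pi.mul_apply, Pi.smul_apply, smul_eq_mul]
  rcases lt_or_ge x 0 with hx | hx
  · simp [gammaPDF_of_neg hx]
  · rw [gammaPDF_of_nonneg hx, gammaPDF_of_nonneg hx, ← ENNReal.ofReal_mul' hx,
      ← ENNReal.ofReal_mul ha.le, Real.Gamma_add_one ha.ne']
    congr 1
    have hΓ := (Real.Gamma_pos_of_pos ha).ne'
    have hpow : x ^ (a - 1) * x = x ^ a := by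
      rcases hx.eq_or_lt with rfl | hx
      · rw [mul_zero, Real.zero_rpow ha.ne']
      · rw [← Real.rpow_add_one hx.ne', sub_add_cancel]
    rw [add_sub_cancel_right, ← hpow]
    simp only [Real.one_rpow]
    field_simp

theorem gammaMeasure_withDensity_exp {a r : ℝ} (hr : 0 < r) :
    (gammaMeasure a 1).withDensity
        (fun x => ENNReal.ofReal (r ^ a) * ENNReal.ofReal (Real.exp (-((r - 1) * x)))) =
      gammaMeasure a r := by
  have hpdf : ∀ s, Measurable (gammaPDF a s) := fun s =>
    (measurable_gammaPDFReal a s).ennreal_ofReal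
  rw [gammaMeasure, gammaMeasure, ← withDensity_mul _ (hpdf 1) (by fun_prop)]
  congr 1
  funext x
  simp only [Pi.mul_apply]
  rcases lt_or_ge x 0 with hx | hx
  · simp [gammaPDF_of_neg hx]
  · rw [gammaPDF_of_nonneg hx, gammaPDF_of_nonneg hx, ← ENNReal.ofReal_mul (by positivity),
      ← ENNReal.ofReal_mul' (by positivity)]
    congr 1
    rw [show -(r * x) = -(1 * x) + -((r - 1) * x) by ring, Real.exp_add, Real.one_rpow]
    ring

theorem gammaMeasure_map_mul {a r : ℝ} (hr : 0 < r) :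
    (gammaMeasure a r).map (r * ·) = gammaMeasure a 1 := by
  have hpdf : ∀ s, Measurable (gammaPDF a s) := fun s =>
    (measurable_gammaPDFReal a s).ennreal_ofReal
  have hm : Measurable fun x : ℝ => r * x := by fun_prop
  have key : ∀ x, gammaPDF a r x = ENNReal.ofReal r * gammaPDF a 1 (r * x) := by
    intro x
    rcases lt_or_ge x 0 with hx | hx
    · simp [gammaPDF_of_neg hx, gammaPDF_of_neg (mul_neg_of_pos_of_neg hr hx)]
    · rw [gammaPDF_of_nonneg hx, gammaPDF_of_nonneg (by positivity), ← ENNReal.ofReal_mul hr.le]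
      congr 1
      rw [Real.mul_rpow hr.le hx, Real.rpow_sub_one hr.ne', Real.one_rpow]
      field_simp
  ext s hs
  rw [Measure.map_apply hm hs, gammaMeasure, gammaMeasure, withDensity_apply _ (hm hs),
    withDensity_apply _ hs, ← lintegral_indicator (hm hs), ← lintegral_indicator hs]
  have h1 : ∀ x, ((fun x => r * x) ⁻¹' s).indicator (gammaPDF a r) x =
      ENNReal.ofReal r * s.indicator (gammaPDF a 1) (r * x) := by
    intro x
    by_cases hx : r * x ∈ s
    · rw [Set.indicator_of_mem (show x ∈ (fun x => r * x) ⁻¹' s from hx), Set.indicator_of_mem hx,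
        key]
    · rw [Set.indicator_of_notMem (show x ∉ (fun x => r * x) ⁻¹' s from hx),
        Set.indicator_of_notMem hx, mul_zero]
  simp_rw [h1]
  have h2 := (hpdf 1).indicator hs
  rw [lintegral_const_mul _ (show Measurable fun x => s.indicator (gammaPDF a 1) (r * x) from
      h2.comp hm), ← lintegral_map h2 hm, Real.map_volume_mul_left hr.ne',
    lintegral_smul_measure, smul_eq_mul, ← mul_assoc, abs_of_pos (inv_pos.2 hr),
    ← ENNReal.ofReal_mul hr.le, mul_inv_cancel₀ hr.ne', ENNReal.ofReal_one, one_mul]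

theorem add_single_pos {ι : Type*} [DecidableEq ι] {α : ι → ℝ} (hα : ∀ i, 0 < α i) (o i : ι) :
    0 < (α + Pi.single o 1 : ι → ℝ) i := by
  refine add_pos_of_pos_of_nonneg (hα i) ?_
  by_cases hi : i = o
  · subst hi; simp
  · simp [hi]

variable {ι : Type*} [Fintype ι]

theorem measurable_normalize : Measurable fun (g : ι → ℝ) i => g i / ∑ j, g j := by
  fun_prop

theorem ae_pos_gammaMeasure (a : ℝ) : ∀ᵐ x ∂gammaMeasure a 1, 0 < x := by
  have h0 : gammaMeasure a 1 (Set.Iic 0) = 0 := by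
    rw [gammaMeasure, withDensity_apply _ measurableSet_Iic, setLIntegral_congr Iio_ae_eq_Iic.symm]
    exact lintegral_gammaPDF_of_nonpos le_rfl
  rw [ae_iff]
  convert h0 using 2
  ext x
  simp

/-- Tilting by `exp (-(r - 1) * ∑ g)` amounts to a scaling of the Gamma variables, which does not
affect their normalization. -/
theorem lintegral_normalize_mul_exp (α : ι → ℝ) (hα : ∀ i, 0 < α i) {F : (ι → ℝ) → ℝ≥0∞}
    (hF : Measurable F) {r : ℝ} (hr : 0 < r) :
    ENNReal.ofReal (r ^ ∑ i, α i) *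
        ∫⁻ g, F (fun i => g i / ∑ j, g j) * ENNReal.ofReal (Real.exp (-((r - 1) * ∑ i, g i)))
          ∂(Measure.pi fun i => gammaMeasure (α i) 1) =
      ∫⁻ g, F (fun i => g i / ∑ j, g j) ∂(Measure.pi fun i => gammaMeasure (α i) 1) := by
  have hp : ∀ s, 0 < s → ∀ i, IsProbabilityMeasure (gammaMeasure (α i) s) := fun s hs i =>
    isProbabilityMeasure_gammaMeasure (hα i) hs
  have hp1 := hp 1 one_pos
  have hpr := hp r hr
  have hFn : Measurable fun g : ι → ℝ => F fun i => g i / ∑ j, g j := hF.comp measurable_normalize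
  have hscale : (Measure.pi fun i => gammaMeasure (α i) 1) =
      (Measure.pi fun i => gammaMeasure (α i) r).map fun g i => r * g i := by
    have : ∀ i, SigmaFinite ((gammaMeasure (α i) r).map (r * ·)) := by
      intro i
      rw [gammaMeasure_map_mul hr]
      infer_instance
    rw [Measure.pi_map_pi fun i => by fun_prop]
    simp_rw [gammaMeasure_map_mul hr]
  have hsf : ∀ i, SigmaFinite ((gammaMeasure (α i) 1).withDensity
      (fun x => ENNReal.ofReal (r ^ α i) * ENNReal.ofReal (Real.exp (-((r - 1) * x))))) := by
    intro i
    rw [gammaMeasure_withDensity_exp hr]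
    infer_instance
  have hd := pi_withDensity (fun i => gammaMeasure (α i) 1)
    (fun i x => ENNReal.ofReal (r ^ α i) * ENNReal.ofReal (Real.exp (-((r - 1) * x))))
    (fun i => by fun_prop)
  simp_rw [gammaMeasure_withDensity_exp hr] at hd
  conv_rhs => rw [hscale, lintegral_map hFn (by fun_prop), hd]
  have hprod : ∀ g : ι → ℝ, (∏ i, ENNReal.ofReal (r ^ α i) *
      ENNReal.ofReal (Real.exp (-((r - 1) * g i)))) =
      ENNReal.ofReal (r ^ ∑ i, α i) *
        ENNReal.ofReal (Real.exp (-((r - 1) * ∑ i, g i))) := by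
    intro g
    rw [Finset.prod_mul_distrib, ← ENNReal.ofReal_prod_of_nonneg fun i _ => by positivity,
      ← ENNReal.ofReal_prod_of_nonneg fun i _ => by positivity, ← Real.exp_sum,
      ← Real.rpow_sum_of_pos hr, Finset.mul_sum, Finset.sum_neg_distrib]
  simp_rw [hprod]
  rw [lintegral_withDensity_eq_lintegral_mul _ (by fun_prop) (by fun_prop),
    ← lintegral_const_mul _ (by fun_prop)]
  refine lintegral_congr fun g => ?_
  simp only [Pi.mul_apply]
  have : (fun i => r * g i / ∑ j, r * g j) = fun i => g i / ∑ j, g j := by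
    funext i
    rw [← Finset.mul_sum, mul_div_mul_left _ _ hr.ne']
  rw [this]
  ring

/-- The sum of Gamma variables is independent of their normalization, in the form that is needed:
`E[F / ∑ g] = E[F] / (∑ α - 1)` for functions `F` of the normalization. This follows by integrating
`lintegral_normalize_mul_exp` over `r ∈ (1, ∞)`. -/
theorem lintegral_normalize_div_sum [Nonempty ι] (α : ι → ℝ) (hα : ∀ i, 0 < α i)
    (h1 : 1 < ∑ i, α i) {F : (ι → ℝ) → ℝ≥0∞} (hF : Measurable F) :
    ∫⁻ g, F (fun i => g i / ∑ j, g j) * ENNReal.ofReal (1 / ∑ i, g i)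
        ∂(Measure.pi fun i => gammaMeasure (α i) 1) =
      ENNReal.ofReal (1 / (∑ i, α i - 1)) *
        ∫⁻ g, F (fun i => g i / ∑ j, g j) ∂(Measure.pi fun i => gammaMeasure (α i) 1) := by
  set N := ∑ i, α i with hN
  have hp1 : ∀ i, IsProbabilityMeasure (gammaMeasure (α i) 1) := fun i =>
    isProbabilityMeasure_gammaMeasure (hα i) one_pos
  have hFn : Measurable fun g : ι → ℝ => F fun i => g i / ∑ j, g j := hF.comp measurable_normalize
  have hall : ∀ᵐ g ∂Measure.pi fun i => gammaMeasure (α i) 1, ∀ i, 0 < g i :=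
    ae_all_iff.2 fun i => (Measure.quasiMeasurePreserving_eval _ i).ae (ae_pos_gammaMeasure (α i))
  have hexp : ∀ S : ℝ, 0 < S →
      ∫⁻ r in Set.Ioi (1 : ℝ), ENNReal.ofReal (Real.exp (-((r - 1) * S))) =
        ENNReal.ofReal (1 / S) := by
    intro S hS
    have hfun : ∀ r : ℝ, Real.exp (-((r - 1) * S)) = Real.exp S * Real.exp (-S * r) := by
      intro r
      rw [← Real.exp_add]
      congr 1
      ring
    have hint : IntegrableOn (fun r : ℝ => Real.exp S * Real.exp (-S * r)) (Set.Ioi 1) :=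
      (integrableOn_exp_mul_Ioi (by linarith) 1).const_mul _
    simp_rw [hfun]
    rw [← ofReal_integral_eq_lintegral_ofReal hint (ae_of_all _ fun r => by positivity),
      integral_const_mul, integral_exp_mul_Ioi (by linarith)]
    congr 1
    rw [mul_one, neg_div_neg_eq, mul_div_assoc', ← Real.exp_add, add_neg_cancel, Real.exp_zero]
  have hpow : ∫⁻ r in Set.Ioi (1 : ℝ), ENNReal.ofReal (r ^ (-N)) =
      ENNReal.ofReal (1 / (N - 1)) := by
    rw [← ofReal_integral_eq_lintegral_ofReal (integrableOn_Ioi_rpow_of_lt (by linarith) one_pos),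
      integral_Ioi_rpow_of_lt (by linarith) one_pos]
    · congr 1
      rw [Real.one_rpow, neg_div, ← div_neg]
      congr 1
      ring
    · filter_upwards [ae_restrict_mem measurableSet_Ioi] with r hr
      exact Real.rpow_nonneg (zero_le_one.trans (le_of_lt hr)) _
  calc _ = ∫⁻ g, (∫⁻ r in Set.Ioi (1 : ℝ), F (fun i => g i / ∑ j, g j) *
        ENNReal.ofReal (Real.exp (-((r - 1) * ∑ i, g i))))
          ∂(Measure.pi fun i => gammaMeasure (α i) 1) := by
        refine lintegral_congr_ae ?_
        filter_upwards [hall] with g hg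
        rw [lintegral_const_mul _ (by fun_prop),
          hexp _ (Finset.sum_pos (fun i _ => hg i) Finset.univ_nonempty)]
    _ = ∫⁻ r in Set.Ioi (1 : ℝ), ∫⁻ g, F (fun i => g i / ∑ j, g j) *
        ENNReal.ofReal (Real.exp (-((r - 1) * ∑ i, g i)))
          ∂(Measure.pi fun i => gammaMeasure (α i) 1) := by
        refine lintegral_lintegral_swap (Measurable.aemeasurable ?_)
        refine (hFn.comp measurable_fst).mul ?_
        fun_prop
    _ = ∫⁻ r in Set.Ioi (1 : ℝ), ENNReal.ofReal (r ^ (-N)) *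
        ∫⁻ g, F (fun i => g i / ∑ j, g j) ∂(Measure.pi fun i => gammaMeasure (α i) 1) := by
        refine setLIntegral_congr_fun measurableSet_Ioi fun r hr => ?_
        have hr0 : 0 < r := zero_lt_one.trans hr
        rw [← lintegral_normalize_mul_exp α hα hF hr0, ← mul_assoc,
          ← ENNReal.ofReal_mul (by positivity), ← Real.rpow_add hr0, ← hN, neg_add_cancel,
          Real.rpow_zero, ENNReal.ofReal_one, one_mul]
    _ = _ := by
        rw [lintegral_mul_const _ (by fun_prop), hpow]

/-- Reweighting a Dirichlet law by a coordinate `p o = g o / ∑ g` increments the parameter of `o`: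
the factor `g o` size-biases one Gamma variable, and the factor `1 / ∑ g` only contributes a
constant. -/
theorem lintegral_dirichletVec_mul [DecidableEq ι] [Nonempty ι] (α : ι → ℝ) (hα : ∀ i, 0 < α i)
    (o : ι) {F : (ι → ℝ) → ℝ≥0∞} (hF : Measurable F) :
    ∫⁻ p, ENNReal.ofReal (p o) * F p ∂dirichletVec α =
      ENNReal.ofReal (α o / ∑ i, α i) * ∫⁻ p, F p ∂dirichletVec (α + Pi.single o 1) := by
  set α' := α + Pi.single o 1 with hα'
  have hα'pos : ∀ i, 0 < α' i := add_single_pos hα o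
  have hN : 0 < ∑ i, α i := Finset.sum_pos (fun i _ => hα i) Finset.univ_nonempty
  have hN' : ∑ i, α' i = ∑ i, α i + 1 := by
    simp [hα', Finset.sum_add_distrib]
  have hp1 : ∀ i, IsProbabilityMeasure (gammaMeasure (α i) 1) := fun i =>
    isProbabilityMeasure_gammaMeasure (hα i) one_pos
  have hp2 : IsProbabilityMeasure (gammaMeasure (α o + 1) 1) :=
    isProbabilityMeasure_gammaMeasure (by linarith [hα o]) one_pos
  have hFn : Measurable fun g : ι → ℝ => F fun i => g i / ∑ j, g j := hF.comp measurable_normalize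
  have hall : ∀ᵐ g ∂Measure.pi fun i => gammaMeasure (α i) 1, ∀ i, 0 < g i :=
    ae_all_iff.2 fun i => (Measure.quasiMeasurePreserving_eval _ i).ae (ae_pos_gammaMeasure (α i))
  -- size-biasing the Gamma variable with index `o`
  have bias : ∀ G : (ι → ℝ) → ℝ≥0∞, Measurable G →
      ∫⁻ g, ENNReal.ofReal (g o) * G g ∂(Measure.pi fun i => gammaMeasure (α i) 1) =
        ENNReal.ofReal (α o) * ∫⁻ g, G g ∂(Measure.pi fun i => gammaMeasure (α' i) 1) := by
    intro G hG
    have e : Function.update (fun i => gammaMeasure (α i) 1) o (gammaMeasure (α o + 1) 1) =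
        fun i => gammaMeasure (α' i) 1 := by
      funext i
      rcases eq_or_ne i o with rfl | hi
      · simp [hα']
      · simp [hα', hi]
    rw [← e]
    exact lintegral_pi_mul_eval (fun i => gammaMeasure (α i) 1) o ENNReal.measurable_ofReal
      (gammaMeasure_withDensity_id (hα o)) hG
  rw [dirichletVec, lintegral_map (by fun_prop) measurable_normalize, dirichletVec,
    lintegral_map hF measurable_normalize]
  calc _ = ∫⁻ g, ENNReal.ofReal (g o) *
        (F (fun i => g i / ∑ j, g j) * ENNReal.ofReal (1 / ∑ i, g i))
          ∂(Measure.pi fun i => gammaMeasure (α i) 1) := by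
        refine lintegral_congr_ae ?_
        filter_upwards [hall] with g hg
        rw [div_eq_mul_one_div, ENNReal.ofReal_mul (hg o).le]
        ring
    _ = _ := by
        rw [bias _ (by fun_prop), lintegral_normalize_div_sum α' hα'pos (by linarith) hF, hN',
          add_sub_cancel_right, ← mul_assoc, ← ENNReal.ofReal_mul (hα o).le, mul_one_div]

theorem dirichlet_map_val [Nonempty ι] (α : ι → ℝ) (hα : ∀ i, 0 < α i) :
    (dirichlet α).map Subtype.val = dirichletVec α := by
  rw [dirichlet, (MeasurableEmbedding.subtype_coe
    (isClosed_stdSimplex ℝ ι).measurableSet).map_comap, Subtype.range_coe]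
  exact Measure.restrict_eq_self_of_ae_mem (dirichletVec_ae_mem α hα)

/-- The Dirichlet prior is conjugate to the categorical likelihood. -/
theorem dirichlet_withDensity [DecidableEq ι] [Nonempty ι] (α : ι → ℝ) (hα : ∀ i, 0 < α i)
    (o : ι) :
    (dirichlet α).withDensity (fun p => ENNReal.ofReal (p.1 o)) =
      ENNReal.ofReal (α o / ∑ i, α i) • dirichlet (α + Pi.single o 1) := by
  have hα' := add_single_pos hα o
  have hemb := MeasurableEmbedding.subtype_coe (isClosed_stdSimplex ℝ ι).measurableSet
  have hv : Measurable fun p : stdSimplex ℝ ι => ENNReal.ofReal (p.1 o) :=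
    ((measurable_pi_apply o).comp measurable_subtype_coe).ennreal_ofReal
  ext s hs
  have hs' : MeasurableSet (Subtype.val '' s : Set (ι → ℝ)) := hemb.measurableSet_image.2 hs
  have hind : Measurable ((Subtype.val '' s : Set (ι → ℝ)).indicator (1 : (ι → ℝ) → ℝ≥0∞)) :=
    measurable_one.indicator hs'
  have hval : ∀ p : stdSimplex ℝ ι, (Subtype.val '' s : Set (ι → ℝ)).indicator
      (1 : (ι → ℝ) → ℝ≥0∞) p.1 = s.indicator 1 p := by
    intro p
    by_cases hp : p ∈ s
    · rw [Set.indicator_of_mem hp, Set.indicator_of_mem (Set.mem_image_of_mem _ hp)]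
      rfl
    · rw [Set.indicator_of_notMem hp, Set.indicator_of_notMem
        fun h => hp ((Subtype.val_injective.mem_set_image).1 h)]
  have h := lintegral_dirichletVec_mul α hα o hind
  rw [← dirichlet_map_val α hα, ← dirichlet_map_val _ hα',
    lintegral_map (by fun_prop) measurable_subtype_coe,
    lintegral_map (by fun_prop) measurable_subtype_coe] at h
  simp_rw [hval] at h
  rw [lintegral_indicator_one hs] at h
  rw [withDensity_apply _ hs, Measure.smul_apply, smul_eq_mul, ← h, ← lintegral_indicator hs]
  refine lintegral_congr fun p => ?_
  by_cases hp : p ∈ s <;> simp [hp]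

end Dirichlet

/-! ### Gaussian domination of linear functionals of a Dirichlet vector -/

section GaussianDirichlet

open Filter Topology

variable {ι : Type*} [Fintype ι]

theorem continuous_simplex_apply (o : ι) : Continuous fun p : stdSimplex ℝ ι => p.1 o :=
  (continuous_apply o).comp continuous_subtype_val

theorem integrable_of_continuous_compact {E : Type*} [TopologicalSpace E] [CompactSpace E]
    [MeasurableSpace E] [OpensMeasurableSpace E] {μ : Measure E} [IsFiniteMeasure μ] {G : E → ℝ}
    (hG : Continuous G) : Integrable G μ := by
  obtain ⟨K, hK⟩ := isCompact_univ.exists_bound_of_continuousOn hG.continuousOn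
  exact (integrable_const K).mono' hG.aestronglyMeasurable
    (ae_of_all _ fun x => hK x (Set.mem_univ x))

variable [DecidableEq ι] [Nonempty ι]

theorem integral_dirichlet_mul (α : ι → ℝ) (hα : ∀ i, 0 < α i) (o : ι) (G : stdSimplex ℝ ι → ℝ) :
    ∫ p, p.1 o * G p ∂dirichlet α =
      α o / (∑ i, α i) * ∫ p, G p ∂dirichlet (α + Pi.single o 1) := by
  have hm : Measurable fun p : stdSimplex ℝ ι => ENNReal.ofReal (p.1 o) :=
    (continuous_simplex_apply o).measurable.ennreal_ofReal
  have h := integral_withDensity_eq_integral_toReal_smul (μ := dirichlet α) hm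
    (ae_of_all _ fun _ => ENNReal.ofReal_lt_top) G
  have h0 : 0 ≤ α o / ∑ i, α i :=
    div_nonneg (hα o).le (Finset.sum_nonneg fun i _ => (hα i).le)
  rw [dirichlet_withDensity α hα, integral_smul_measure, ENNReal.toReal_ofReal h0,
    smul_eq_mul] at h
  rw [h]
  refine integral_congr_ae (ae_of_all _ fun p => ?_)
  simp only [smul_eq_mul]
  rw [ENNReal.toReal_ofReal (p.2.1 o)]

/-- The predictive decomposition of a Dirichlet law: sample an outcome from the mean, then update
the parameters. -/
theorem integral_dirichlet_eq_sum (α : ι → ℝ) (hα : ∀ i, 0 < α i) {G : stdSimplex ℝ ι → ℝ}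
    (hG : Continuous G) :
    ∫ p, G p ∂dirichlet α =
      ∑ o, α o / (∑ i, α i) * ∫ p, G p ∂dirichlet (α + Pi.single o 1) := by
  have := isProbabilityMeasure_dirichlet α hα
  simp_rw [← integral_dirichlet_mul α hα]
  have hi : ∀ o, Integrable (fun p : stdSimplex ℝ ι => p.1 o * G p) (dirichlet α) := fun o =>
    integrable_of_continuous_compact ((continuous_simplex_apply o).mul hG)
  rw [← integral_finsetSum _ fun o _ => hi o]
  refine integral_congr_ae (ae_of_all _ fun p => ?_)
  simp only
  rw [← Finset.sum_mul, p.2.2, one_mul]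

theorem integral_dirichlet_apply (α : ι → ℝ) (hα : ∀ i, 0 < α i) (o : ι) :
    ∫ p, p.1 o ∂dirichlet α = α o / ∑ i, α i := by
  have := isProbabilityMeasure_dirichlet _ (add_single_pos hα o)
  simpa using integral_dirichlet_mul α hα o fun _ => 1

omit [DecidableEq ι] [Nonempty ι] in
theorem continuous_simplex_dot (V : ι → ℝ) :
    Continuous fun p : stdSimplex ℝ ι => ∑ o, p.1 o * V o :=
  continuous_finsetSum _ fun o _ => (continuous_simplex_apply o).mul continuous_const

theorem integral_dirichlet_dot (α : ι → ℝ) (hα : ∀ i, 0 < α i) (V : ι → ℝ) :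
    ∫ p, ∑ o, p.1 o * V o ∂dirichlet α = (∑ o, α o * V o) / ∑ i, α i := by
  have := isProbabilityMeasure_dirichlet α hα
  have hi : ∀ o, Integrable (fun p : stdSimplex ℝ ι => p.1 o * V o) (dirichlet α) := fun o =>
    integrable_of_continuous_compact ((continuous_simplex_apply o).mul continuous_const)
  rw [integral_finsetSum _ fun o _ => hi o]
  simp_rw [integral_mul_const, integral_dirichlet_apply α hα]
  rw [Finset.sum_div]
  exact Finset.sum_congr rfl fun o _ => by ring

omit [Nonempty ι] in
theorem sum_add_single_mul (α V : ι → ℝ) (o : ι) :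
    ∑ i, (α + Pi.single o 1 : ι → ℝ) i * V i = ∑ i, α i * V i + V o := by
  simp [add_mul, Finset.sum_add_distrib, Pi.single_apply]

omit [Nonempty ι] in
theorem sum_add_single (α : ι → ℝ) (o : ι) :
    ∑ i, (α + Pi.single o 1 : ι → ℝ) i = ∑ i, α i + 1 := by
  simp [Finset.sum_add_distrib]

omit [DecidableEq ι] in
theorem weighted_mean_mem {α V : ι → ℝ} (hα : ∀ i, 0 < α i) {B : ℝ} (hV0 : ∀ i, 0 ≤ V i)
    (hVB : ∀ i, V i ≤ B) :
    0 ≤ (∑ o, α o * V o) / ∑ i, α i ∧ (∑ o, α o * V o) / ∑ i, α i ≤ B := by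
  have hN : 0 < ∑ i, α i := Finset.sum_pos (fun i _ => hα i) Finset.univ_nonempty
  refine ⟨div_nonneg (Finset.sum_nonneg fun i _ => mul_nonneg (hα i).le (hV0 i)) hN.le, ?_⟩
  rw [div_le_iff₀ hN, Finset.mul_sum]
  exact Finset.sum_le_sum fun i _ => by nlinarith [hα i, hVB i]

theorem integral_dirichlet_dot_sub_sq_le (α : ι → ℝ) (hα : ∀ i, 0 < α i) {V : ι → ℝ} {B : ℝ}
    (hV0 : ∀ i, 0 ≤ V i) (hVB : ∀ i, V i ≤ B) :
    ∫ p, (∑ o, p.1 o * V o - (∑ o, α o * V o) / ∑ i, α i) ^ 2 ∂dirichlet α ≤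
      B ^ 2 / (∑ i, α i + 1) := by
  have := isProbabilityMeasure_dirichlet α hα
  set N := ∑ i, α i with hN
  set m := (∑ o, α o * V o) / N with hm
  have hNpos : 0 < N := Finset.sum_pos (fun i _ => hα i) Finset.univ_nonempty
  have hm0 : 0 ≤ m := (weighted_mean_mem hα hV0 hVB).1
  have hmN : ∑ o, α o * V o = m * N := by rw [hm]; field_simp
  have hB : 0 ≤ B := (hV0 (Classical.arbitrary ι)).trans (hVB _)
  have hD : Continuous fun p : stdSimplex ℝ ι => ∑ o, p.1 o * V o - m :=
    (continuous_simplex_dot V).sub continuous_const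
  have hD0 : ∫ p, (∑ o, p.1 o * V o - m) ∂dirichlet α = 0 := by
    rw [integral_sub (integrable_of_continuous_compact (continuous_simplex_dot V))
      (integrable_const _), integral_dirichlet_dot α hα]
    simp [hm, hN]
  have hmo : ∀ o, ∫ p, (∑ o, p.1 o * V o - m) ∂dirichlet (α + Pi.single o 1) =
      (V o - m) / (N + 1) := by
    intro o
    have := isProbabilityMeasure_dirichlet _ (add_single_pos hα o)
    rw [integral_sub (integrable_of_continuous_compact (continuous_simplex_dot V))
      (integrable_const _), integral_dirichlet_dot _ (add_single_pos hα o), sum_add_single_mul,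
      sum_add_single, hmN, ← hN]
    simp only [integral_const, probReal_univ, one_smul]
    field_simp
    ring
  have hexp : ∀ p : stdSimplex ℝ ι, (∑ o, p.1 o * V o - m) ^ 2 =
      ∑ o, p.1 o * (∑ o, p.1 o * V o - m) * V o - m * (∑ o, p.1 o * V o - m) := by
    intro p
    have : ∀ o, p.1 o * (∑ o, p.1 o * V o - m) * V o =
        (∑ o, p.1 o * V o - m) * (p.1 o * V o) := fun o => by ring
    simp_rw [this]
    rw [← Finset.mul_sum]
    ring
  have hi : ∀ o, Integrable (fun p : stdSimplex ℝ ι => p.1 o * (∑ o, p.1 o * V o - m) * V o)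
      (dirichlet α) := fun o => integrable_of_continuous_compact
    (((continuous_simplex_apply o).mul hD).mul continuous_const)
  simp_rw [hexp]
  rw [integral_sub (integrable_finsetSum _ fun o _ => hi o)
    ((integrable_of_continuous_compact hD).const_mul m), integral_const_mul, hD0,
    integral_finsetSum _ fun o _ => hi o]
  simp_rw [integral_mul_const, integral_dirichlet_mul α hα, hmo]
  rw [mul_zero, sub_zero]
  calc _ ≤ ∑ o, α o / N * (B ^ 2 / (N + 1)) := by
        refine Finset.sum_le_sum fun o _ => ?_
        rw [mul_assoc]
        refine mul_le_mul_of_nonneg_left ?_ (div_nonneg (hα o).le hNpos.le)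
        rw [div_mul_eq_mul_div]
        refine div_le_div_of_nonneg_right ?_ (by linarith)
        nlinarith [hV0 o, hVB o, mul_nonneg hm0 (hV0 o)]
    _ = _ := by
        rw [← Finset.sum_mul, ← Finset.sum_div, ← hN, div_self hNpos.ne', one_mul]

/-- Up to an error that vanishes as the total mass of the parameters grows, a Dirichlet functional
is dominated by its mean, hence by any Gaussian with this mean. -/
theorem integral_dirichlet_le_add (α : ι → ℝ) (hα : ∀ i, 0 < α i) {V : ι → ℝ} {B : ℝ} (hB : 0 < B)
    (hV0 : ∀ i, 0 ≤ V i) (hVB : ∀ i, V i ≤ B) {φ : ℝ → ℝ} (hφ : ConvexOn ℝ Set.univ φ)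
    (hmono : Monotone φ) {C : NNReal} (hL : LipschitzWith C φ) (c : ℝ) :
    ∫ p, φ (∑ o, p.1 o * V o) ∂dirichlet α ≤
      ∫ x, φ ((∑ o, α o * V o) / (∑ i, α i) + c * x) ∂gaussianReal 0 1 +
        C * (B / √(∑ i, α i + 1)) := by
  have := isProbabilityMeasure_dirichlet α hα
  have hvar := integral_dirichlet_dot_sub_sq_le α hα hV0 hVB
  have hN : 0 < ∑ i, α i := Finset.sum_pos (fun i _ => hα i) Finset.univ_nonempty
  set N := ∑ i, α i
  set m := (∑ o, α o * V o) / N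
  have hJ : φ m ≤ ∫ x, φ (m + c * x) ∂gaussianReal 0 1 := by
    have h := integral_gaussianReal_mono hφ hmono hL (m := m) (m' := m) (c := 0) (c' := c) le_rfl
      (by simpa using sq_nonneg c)
    simpa using h
  set ε := B / √(N + 1) with hε
  have hsq : 0 < √(N + 1) := Real.sqrt_pos.2 (by linarith)
  have hε0 : 0 < ε := div_pos hB hsq
  have hε2 : ε ^ 2 = B ^ 2 / (N + 1) := by rw [hε, div_pow, Real.sq_sqrt (by linarith)]
  have hD : Continuous fun p : stdSimplex ℝ ι => ∑ o, p.1 o * V o - m :=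
    (continuous_simplex_dot V).sub continuous_const
  -- `|d| ≤ (ε + d² / ε) / 2` turns the variance bound into a bound on the absolute deviation
  have hpt : ∀ p : stdSimplex ℝ ι, φ (∑ o, p.1 o * V o) ≤
      φ m + C * ((ε + (∑ o, p.1 o * V o - m) ^ 2 / ε) / 2) := by
    intro p
    set d := ∑ o, p.1 o * V o - m with hd
    have h1 := hL.dist_le_mul (∑ o, p.1 o * V o) m
    rw [Real.dist_eq, Real.dist_eq, ← hd] at h1
    have h2 : |d| ≤ (ε + d ^ 2 / ε) / 2 := by
      have : 2 * |d| * ε ≤ (ε + d ^ 2 / ε) * ε := by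
        rw [add_mul, div_mul_cancel₀ _ hε0.ne', ← sq_abs d]
        nlinarith [sq_nonneg (ε - |d|)]
      have := le_of_mul_le_mul_right this hε0
      linarith
    have h3 := le_abs_self (φ (∑ o, p.1 o * V o) - φ m)
    have h4 := mul_le_mul_of_nonneg_left h2 C.2
    simp only [NNReal.val_eq_coe] at h4
    linarith
  have hi : Integrable (fun p : stdSimplex ℝ ι =>
      φ m + C * ((ε + (∑ o, p.1 o * V o - m) ^ 2 / ε) / 2)) (dirichlet α) := by
    refine integrable_of_continuous_compact ?_
    exact continuous_const.add (continuous_const.mul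
      ((continuous_const.add ((hD.pow 2).div_const ε)).div_const 2))
  have hsqi : Integrable (fun p : stdSimplex ℝ ι => (∑ o, p.1 o * V o - m) ^ 2 / ε)
      (dirichlet α) := integrable_of_continuous_compact ((hD.pow 2).div_const ε)
  have h := integral_mono (integrable_of_continuous_compact
    (hL.continuous.comp (continuous_simplex_dot V))) hi hpt
  have hval : ∫ p, (φ m + C * ((ε + (∑ o, p.1 o * V o - m) ^ 2 / ε) / 2)) ∂dirichlet α =
      φ m + C * ((ε + (∫ p, (∑ o, p.1 o * V o - m) ^ 2 ∂dirichlet α) / ε) / 2) := by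
    have hi' : Integrable (fun p : stdSimplex ℝ ι =>
        C * ((ε + (∑ o, p.1 o * V o - m) ^ 2 / ε) / 2)) (dirichlet α) :=
      (((integrable_const ε).add hsqi).div_const 2).const_mul _
    rw [integral_add (integrable_const _) hi', integral_const_mul,
      integral_div, integral_add (integrable_const _) hsqi, integral_div ε]
    simp only [integral_const, probReal_univ, one_smul]
  rw [hval] at h
  refine h.trans (add_le_add hJ (mul_le_mul_of_nonneg_left ?_ C.2))
  rw [← hε2] at hvar
  have h5 : (∫ p, (∑ o, p.1 o * V o - m) ^ 2 ∂dirichlet α) / ε ≤ ε := by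
    rw [div_le_iff₀ hε0]
    nlinarith
  linarith

omit [DecidableEq ι] in
/-- One step of the Pólya urn: the predictive decomposition changes the mean by a centred bounded
amount, which is dominated by the decrease `B² / N - B² / (N + 1)` of the Gaussian variance. -/
theorem sum_integral_gaussianReal_le (α : ι → ℝ) (hα : ∀ i, 0 < α i) {V : ι → ℝ} {B : ℝ}
    (hB : 0 < B) (hV0 : ∀ i, 0 ≤ V i) (hVB : ∀ i, V i ≤ B) {φ : ℝ → ℝ}
    (hφ : ConvexOn ℝ Set.univ φ) {C : NNReal} (hL : LipschitzWith C φ) :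
    ∑ o, α o / (∑ i, α i) * ∫ x, φ ((∑ i, α i * V i + V o) / (∑ i, α i + 1) +
        B / √(∑ i, α i + 1) * x) ∂gaussianReal 0 1 ≤
      ∫ x, φ ((∑ i, α i * V i) / (∑ i, α i) + B / √(∑ i, α i) * x) ∂gaussianReal 0 1 := by
  have hN : 0 < ∑ i, α i := Finset.sum_pos (fun i _ => hα i) Finset.univ_nonempty
  set N := ∑ i, α i with hNdef
  set m := (∑ i, α i * V i) / N with hm
  have hmN : ∑ o, α o * V o = m * N := by rw [hm]; field_simp
  set c := B / √(N + 1) with hc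
  set s := B / √(N * (N + 1)) with hs
  have hs0 : 0 < s := div_pos hB (Real.sqrt_pos.2 (by positivity))
  have hint : ∀ b, Integrable (fun x => φ (b + c * x)) (gaussianReal 0 1) := fun b =>
    integrable_gaussianReal_of_lipschitzWith (lipschitzWith_comp_affine hL b c) _ _
  set ψ : ℝ → ℝ := fun x => ∫ y, φ (m + x + c * y) ∂gaussianReal 0 1 with hψ
  have hψc : ConvexOn ℝ Set.univ ψ := by
    refine integral_convexOn_of_integrand_ae convex_univ (ae_of_all _ fun y => ?_)
      fun x _ => hint _
    refine ⟨convex_univ, fun x _ x' _ a b ha hb hab => ?_⟩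
    refine le_trans (le_of_eq (congrArg φ ?_)) (hφ.2 (Set.mem_univ _) (Set.mem_univ _) ha hb hab)
    simp only [smul_eq_mul]
    obtain rfl : b = 1 - a := by linarith
    ring
  have hψL : LipschitzWith (C * ‖(1 : ℝ)‖₊) ψ :=
    lipschitzWith_integral (fun x => hint _) fun y => by
      simpa [add_right_comm] using lipschitzWith_comp_affine hL (m + c * y) 1
  have hX : ∀ o, m + (V o - m) / (N + 1) = (∑ i, α i * V i + V o) / (N + 1) := by
    intro o
    rw [hmN]
    field_simp
    ring
  have hsN : B / (N + 1) ≤ s := by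
    refine div_le_div_of_nonneg_left hB.le (Real.sqrt_pos.2 (by positivity)) ?_
    rw [Real.sqrt_le_left (by linarith)]
    nlinarith
  have key := sum_le_integral_gaussianReal (w := fun o => α o / N)
    (X := fun o => (V o - m) / (N + 1)) (fun o => div_nonneg (hα o).le hN.le)
    (by rw [← Finset.sum_div, ← hNdef, div_self hN.ne']) ?_ (a := -m / (N + 1)) hs0
    (fun o => div_le_div_of_nonneg_right (by linarith [hV0 o]) (by linarith)) (fun o => ?_) hψc hψL
  · simp only [hψ, hX] at key
    refine key.trans_eq ?_
    refine integral_gaussianReal_add hL m s c _ ?_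
    rw [hs, hc, div_pow, div_pow, div_pow, Real.sq_sqrt (by positivity),
      Real.sq_sqrt (by positivity), Real.sq_sqrt hN.le]
    field_simp
    ring
  · have : ∀ o, α o / N * ((V o - m) / (N + 1)) =
        α o * V o * (1 / (N * (N + 1))) - α o * (m / (N * (N + 1))) := by
      intro o
      field_simp
    simp_rw [this]
    rw [Finset.sum_sub_distrib, ← Finset.sum_mul, ← Finset.sum_mul, hmN, ← hNdef]
    ring
  · calc (V o - m) / (N + 1) = -m / (N + 1) + V o / (N + 1) := by ring
      _ ≤ -m / (N + 1) + B / (N + 1) := by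
        gcongr
        exact hVB o
      _ ≤ _ := by linarith

/-- A linear functional, with values in `[0, B]`, of a Dirichlet vector with total parameter mass
`N` is dominated by a Gaussian whose mean is at least as large and whose variance is at least
`B² / N`. -/
theorem integral_dirichlet_le_integral_gaussianReal (α : ι → ℝ) (hα : ∀ i, 0 < α i) {V : ι → ℝ}
    {B : ℝ} (hB : 0 < B) (hV0 : ∀ i, 0 ≤ V i) (hVB : ∀ i, V i ≤ B) {φ : ℝ → ℝ}
    (hφ : ConvexOn ℝ Set.univ φ) (hmono : Monotone φ) {C : NNReal} (hL : LipschitzWith C φ)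
    {m c : ℝ} (hm : (∑ o, α o * V o) / (∑ i, α i) ≤ m) (hc : B ^ 2 / (∑ i, α i) ≤ c ^ 2) :
    ∫ p, φ (∑ o, p.1 o * V o) ∂dirichlet α ≤ ∫ x, φ (m + c * x) ∂gaussianReal 0 1 := by
  have key : ∀ k : ℕ, ∀ α : ι → ℝ, (∀ i, 0 < α i) → ∫ p, φ (∑ o, p.1 o * V o) ∂dirichlet α ≤
      ∫ x, φ ((∑ o, α o * V o) / (∑ i, α i) + B / √(∑ i, α i) * x) ∂gaussianReal 0 1 +
        C * (B / √(∑ i, α i + k + 1)) := by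
    intro k
    induction k with
    | zero =>
      intro α hα
      simpa using integral_dirichlet_le_add α hα hB hV0 hVB hφ hmono hL _
    | succ k ih =>
      intro α hα
      have hN : 0 < ∑ i, α i := Finset.sum_pos (fun i _ => hα i) Finset.univ_nonempty
      have hG : Continuous fun p : stdSimplex ℝ ι => φ (∑ o, p.1 o * V o) :=
        hL.continuous.comp (continuous_simplex_dot V)
      rw [integral_dirichlet_eq_sum α hα hG]
      refine (Finset.sum_le_sum fun o _ => mul_le_mul_of_nonneg_left
        (ih _ (add_single_pos hα o)) (div_nonneg (hα o).le hN.le)).trans ?_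
      simp_rw [sum_add_single_mul, sum_add_single, mul_add]
      rw [Finset.sum_add_distrib, ← Finset.sum_mul, ← Finset.sum_div, div_self hN.ne', one_mul]
      refine add_le_add (sum_integral_gaussianReal_le α hα hB hV0 hVB hφ hL) (le_of_eq ?_)
      push_cast
      ring_nf
  have hN : 0 < ∑ i, α i := Finset.sum_pos (fun i _ => hα i) Finset.univ_nonempty
  have hlim : Tendsto (fun k : ℕ =>
      ∫ x, φ ((∑ o, α o * V o) / (∑ i, α i) + B / √(∑ i, α i) * x) ∂gaussianReal 0 1 +
        C * (B / √(∑ i, α i + k + 1))) atTop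
      (𝓝 (∫ x, φ ((∑ o, α o * V o) / (∑ i, α i) + B / √(∑ i, α i) * x) ∂gaussianReal 0 1 +
        C * 0)) := by
    refine Tendsto.const_add _ (Tendsto.const_mul _ (Tendsto.const_div_atTop ?_ B))
    refine Real.tendsto_sqrt_atTop.comp (tendsto_atTop_add_const_right _ _
      (tendsto_atTop_add_const_left _ _ tendsto_natCast_atTop_atTop))
  have h := ge_of_tendsto' hlim fun k => key k α hα
  rw [mul_zero, add_zero] at h
  refine h.trans (integral_gaussianReal_mono hφ hmono hL hm ?_)
  rwa [div_pow, Real.sq_sqrt hN.le]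

end GaussianDirichlet

/-! ### The posterior law of the MDP -/

section Posterior

variable {H : ℕ} {X A : Type*} [Fintype X]

/-- The likelihood of the recorded outcomes, given the triples at which they were recorded. -/
def likelihood (M : MDP H X A) (D : List (Transition H X A)) : ℝ≥0∞ :=
  (D.map fun τ => toPMF (M τ.1) τ.2).prod

theorem likelihood_append (M : MDP H X A) (D D' : List (Transition H X A)) :
    likelihood M (D ++ D') = likelihood M D * likelihood M D' := by
  simp [likelihood]

theorem measurable_likelihood (D : List (Transition H X A)) :
    Measurable fun M : MDP H X A => likelihood M D := by
  induction D with
  | nil => simp [likelihood]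
  | cons τ D ih =>
    simp only [likelihood, List.map_cons, List.prod_cons] at ih ⊢
    exact ((measurable_toPMF_apply τ.2).comp (measurable_pi_apply τ.1)).mul ih

/-- The law of an episode factors into the likelihood and a term that does not depend on the
MDP. -/
theorem exists_rollout_eq_mul_likelihood (π : Policy H X A) (t : ℕ) (x : X) :
    ∃ k : Episode H X A → ℝ≥0∞, ∀ (M : MDP H X A) e, rollout M π t x e = k e * likelihood M e := by
  classical
  induction hm : H - t generalizing t x with
  | zero =>
    have ht : ¬ t < H := by omega
    refine ⟨fun e => PMF.pure [] e, fun M e => ?_⟩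
    rw [rollout, dif_neg ht]
    by_cases he : e = []
    · simp [he, likelihood]
    · simp [PMF.pure_apply, he]
  | succ m ih =>
    have ht : t < H := by omega
    choose k hk using fun x' => ih (t + 1) x' (by omega)
    refine ⟨fun e => ∑' o : Outcome X, ∑' e',
      if e = ((⟨t, ht⟩, x, π ⟨t, ht⟩ x), o) :: e' then k o.2 e' else 0, fun M e => ?_⟩
    rw [rollout, dif_pos ht]
    simp only [PMF.bind_apply, PMF.map_apply]
    rw [← ENNReal.tsum_mul_right]
    refine tsum_congr fun o => ?_
    rw [← ENNReal.tsum_mul_left, ← ENNReal.tsum_mul_right]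
    refine tsum_congr fun e' => ?_
    by_cases he : e = ((⟨t, ht⟩, x, π ⟨t, ht⟩ x), o) :: e'
    · subst he
      simp only [if_true, hk, likelihood, List.map_cons, List.prod_cons]
      ring
    · simp [he]

variable [DecidableEq X] [DecidableEq A] [Fintype A] [Nonempty A]

/-- The probability of a history depends on the MDP only through the likelihood: the actions are
chosen from the history and from independent noise. -/
theorem exists_historyLaw_eq_mul_likelihood (ag : Agent H X A) (ρ : PMF X) (n : ℕ) :
    ∃ c : History H X A → ℝ≥0∞, ∀ M h,
      ag.historyLaw ρ M n h = c h * likelihood M h.buffer := by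
  classical
  induction n with
  | zero =>
    refine ⟨fun h => if h = ([] : List (Episode H X A)) then 1 else 0, fun M h => ?_⟩
    refine (PMF.pure_apply (α := History H X A) _ h).trans ?_
    by_cases he : h = ([] : List (Episode H X A))
    · simp [he, likelihood, History.buffer]
    · simp [he]
  | succ n ih =>
    obtain ⟨c, hc⟩ := ih
    choose k hk using fun (π : Policy H X A) x => exists_rollout_eq_mul_likelihood π 0 x
    refine ⟨fun h => ∑' h' : History H X A, ∑' π, ∑' x, ∑' e, if h = List.append h' [e] then
      c h' * ag.policyLaw h'.buffer π * ρ x * k π x e else 0, fun M h => ?_⟩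
    simp only [Agent.historyLaw, PMF.bind_apply, ← ENNReal.tsum_mul_right, ← ENNReal.tsum_mul_left]
    refine tsum_congr fun h' => tsum_congr fun π => tsum_congr fun x => ?_
    have hmap : PMF.map (β := History H X A) (fun e => List.append h' [e]) (rollout M π 0 x) h =
        ∑' e, if h = List.append h' [e] then rollout M π 0 x e else 0 :=
      PMF.map_apply (β := History H X A) _ _ _
    rw [hmap, ← ENNReal.tsum_mul_left, ← ENNReal.tsum_mul_left, ← ENNReal.tsum_mul_left]
    refine tsum_congr fun e => ?_
    by_cases he : h = List.append h' [e]
    · have hb : h.buffer = h'.buffer ++ e := by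
        rw [he]
        exact (List.flatten_append (L₁ := h') (L₂ := [e])).trans (by simp [History.buffer])
      simp only [if_pos he, hc, hk, hb, likelihood_append]
      ring
    · simp [he]

/-- The parameters of the posterior Dirichlet laws: the prior parameters plus the outcome counts. -/
def posteriorParam (α : Triple H X A → Outcome X → ℝ) (D : List (Transition H X A)) :
    Triple H X A → Outcome X → ℝ :=
  fun y o => α y o + ((Agent.outcomes D y).count o : ℝ)

omit [Fintype X] [Fintype A] [Nonempty A] in
theorem posteriorParam_cons (α : Triple H X A → Outcome X → ℝ) (τ : Transition H X A)
    (D : List (Transition H X A)) :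
    posteriorParam α (τ :: D) =
      Function.update (posteriorParam α D) τ.1 (posteriorParam α D τ.1 + Pi.single τ.2 1) := by
  funext y o
  rcases eq_or_ne y τ.1 with rfl | hy
  · simp only [posteriorParam, Agent.outcomes, decide_true, List.filter_cons_of_pos, List.map_cons,
      List.count_cons, Function.update_self, Pi.add_apply, Pi.single_apply]
    by_cases ho : o = τ.2
    · simp [ho, add_assoc]
    · simp [ho, Ne.symm ho]
  · simp [posteriorParam, Agent.outcomes, hy, Ne.symm hy]

omit [Fintype X] [Fintype A] [Nonempty A] in
theorem posteriorParam_pos {α : Triple H X A → Outcome X → ℝ} (hα : ∀ y o, 0 < α y o)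
    (D : List (Transition H X A)) (y : Triple H X A) (o : Outcome X) :
    0 < posteriorParam α D y o :=
  add_pos_of_pos_of_nonneg (hα y o) (Nat.cast_nonneg _)

omit [Fintype A] [Nonempty A] in
theorem sum_posteriorParam (α : Triple H X A → Outcome X → ℝ) (D : List (Transition H X A))
    (y : Triple H X A) :
    ∑ o, posteriorParam α D y o = ∑ o, α y o + (Agent.outcomes D y).length := by
  simp only [posteriorParam, Finset.sum_add_distrib]
  rw [← Nat.cast_sum]
  congr 2
  induction Agent.outcomes D y with
  | nil => simp
  | cons o l ih => simp [List.count_cons, Finset.sum_add_distrib, ih]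

variable [Nonempty X]

omit [DecidableEq X] [DecidableEq A] [Nonempty A] in
theorem isProbabilityMeasure_prior {α : Triple H X A → Outcome X → ℝ} (hα : ∀ y o, 0 < α y o) :
    IsProbabilityMeasure (Agent.prior α) := by
  have := fun y => isProbabilityMeasure_dirichlet (α y) (hα y)
  unfold Agent.prior
  infer_instance

omit [Nonempty A] in
/-- Conjugacy for the whole buffer: up to a constant, the likelihood turns the prior into the
posterior. -/
theorem exists_lintegral_likelihood_mul (α : Triple H X A → Outcome X → ℝ) (hα : ∀ y o, 0 < α y o)
    (D : List (Transition H X A)) :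
    ∃ c : ℝ≥0∞, ∀ G : MDP H X A → ℝ≥0∞, Measurable G →
      ∫⁻ M, likelihood M D * G M ∂Agent.prior α =
        c * ∫⁻ M, G M ∂Agent.prior (posteriorParam α D) := by
  induction D with
  | nil =>
    refine ⟨1, fun G _ => ?_⟩
    have : posteriorParam α [] = α := by
      funext y o
      simp [posteriorParam, Agent.outcomes]
    simp [likelihood, this]
  | cons τ D ih =>
    obtain ⟨c, hc⟩ := ih
    set αD := posteriorParam α D with hαD
    have hpos : ∀ y o, 0 < αD y o := posteriorParam_pos hα D
    have hp := fun y => isProbabilityMeasure_dirichlet (αD y) (hpos y)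
    have hp' := isProbabilityMeasure_dirichlet _ (add_single_pos (hpos τ.1) τ.2)
    refine ⟨c * ENNReal.ofReal (αD τ.1 τ.2 / ∑ o, αD τ.1 o), fun G hG => ?_⟩
    have hm := measurable_toPMF_apply τ.2
    have hm' : Measurable fun M : MDP H X A => toPMF (M τ.1) τ.2 :=
      hm.comp (measurable_pi_apply τ.1)
    have hl : ∀ M : MDP H X A, likelihood M (τ :: D) * G M =
        likelihood M D * (toPMF (M τ.1) τ.2 * G M) := by
      intro M
      simp only [likelihood, List.map_cons, List.prod_cons]
      ring
    simp_rw [hl]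
    have hmG : Measurable fun M : MDP H X A => toPMF (M τ.1) τ.2 * G M := hm'.mul hG
    rw [hc _ hmG, mul_assoc, Agent.prior,
      lintegral_pi_mul_eval (fun y => dirichlet (αD y)) τ.1 hm
        (dirichlet_withDensity (αD τ.1) (hpos τ.1) τ.2) hG, Agent.prior, posteriorParam_cons]
    congr 4
    funext y
    rcases eq_or_ne y τ.1 with rfl | hy
    · simp [hαD]
    · simp [hy, hαD]

/-- Given the history, the MDP follows the posterior Dirichlet law and is independent of the noise
of the next episode. -/
theorem map_cond_jointLaw (ag : Agent H X A) (ρ : PMF X) {α : Triple H X A → Outcome X → ℝ}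
    (hα : ∀ y o, 0 < α y o) (n : ℕ) (h : History H X A)
    (hh : ag.jointLaw ρ α n {ω | ω.1.2 = h} ≠ 0) :
    (ProbabilityTheory.cond (ag.jointLaw ρ α n) {ω | ω.1.2 = h}).map
        (fun ω => (ω.1.1, ω.2)) =
      (Agent.prior (posteriorParam α h.buffer)).prod (Agent.noise H X A) := by
  have hprior := isProbabilityMeasure_prior hα
  have hpost := isProbabilityMeasure_prior (posteriorParam_pos hα h.buffer)
  have hjoint := ag.isProbabilityMeasure_jointLaw ρ α hα n
  obtain ⟨c, hc⟩ := exists_historyLaw_eq_mul_likelihood ag ρ n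
  obtain ⟨K, hK⟩ := exists_lintegral_likelihood_mul α hα h.buffer
  have hg : Measurable fun ω : (MDP H X A × History H X A) × (Triple H X A → ℝ) =>
      (ω.1.1, ω.2) := by fun_prop
  have hS : MeasurableSet {ω : (MDP H X A × History H X A) × (Triple H X A → ℝ) | ω.1.2 = h} :=
    (measurable_snd.comp measurable_fst) (MeasurableSet.singleton h)
  have key : ∀ T, MeasurableSet T →
      ag.jointLaw ρ α n ({ω | ω.1.2 = h} ∩ (fun ω => (ω.1.1, ω.2)) ⁻¹' T) =
        c h * K * (Agent.prior (posteriorParam α h.buffer)).prod (Agent.noise H X A) T := by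
    intro T hT
    have hTm : Measurable fun M => Agent.noise H X A (Prod.mk M ⁻¹' T) :=
      measurable_measure_prodMk_left hT
    have hmeas : MeasurableSet ({ω : (MDP H X A × History H X A) × (Triple H X A → ℝ) |
        ω.1.2 = h} ∩ (fun ω => (ω.1.1, ω.2)) ⁻¹' T) := hS.inter (hg hT)
    have hlT : Measurable fun M =>
        likelihood M h.buffer * Agent.noise H X A (Prod.mk M ⁻¹' T) :=
      (measurable_likelihood _).mul hTm
    rw [Agent.jointLaw, Measure.prod_apply hmeas,
      Measure.lintegral_compProd (measurable_measure_prodMk_left hmeas), Measure.prod_apply hT,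
      mul_assoc, ← hK _ hTm, ← lintegral_const_mul _ hlT]
    refine lintegral_congr fun M => ?_
    have hsl : ∀ h', Agent.noise H X A (Prod.mk (M, h') ⁻¹' ({ω | ω.1.2 = h} ∩
        (fun ω : (MDP H X A × History H X A) × (Triple H X A → ℝ) => (ω.1.1, ω.2)) ⁻¹' T)) =
        ({h} : Set (History H X A)).indicator
          (fun _ => Agent.noise H X A (Prod.mk M ⁻¹' T)) h' := by
      intro h'
      by_cases hh' : h' = h
      · rw [Set.indicator_of_mem (by simpa using hh')]
        congr 1
        ext z
        simp [hh']
      · rw [Set.indicator_of_notMem (by simpa using hh'), ← measure_empty (μ := Agent.noise H X A)]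
        congr 1
        ext z
        simp [hh']
    simp_rw [hsl]
    rw [lintegral_indicator_const (MeasurableSet.singleton h)]
    have hker : ag.historyKernel ρ n M {h} = ag.historyLaw ρ M n h :=
      PMF.toMeasure_apply_singleton _ _ (MeasurableSet.singleton h)
    rw [hker, hc]
    ring
  have hmass : ag.jointLaw ρ α n {ω | ω.1.2 = h} = c h * K := by
    have := key Set.univ MeasurableSet.univ
    rwa [Set.preimage_univ, Set.inter_univ, measure_univ, mul_one] at this
  ext T hT
  rw [Measure.map_apply hg hT, cond_apply hS, key T hT, hmass, ← mul_assoc,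
    ENNReal.inv_mul_cancel (hmass ▸ hh) (hmass ▸ measure_ne_top _ _), one_mul]

end Posterior

/-! ### The Bellman recursion for the optimal value -/

section Bellman

variable {H : ℕ} {X A : Type*} [Fintype X]

theorem toReal_toPMF {ι : Type*} [Fintype ι] (p : stdSimplex ℝ ι) (i : ι) :
    (toPMF p i).toReal = p.1 i :=
  ENNReal.toReal_ofReal (p.2.1 i)

theorem hasSum_toReal {α : Type*} (p : PMF α) : HasSum (fun a => (p a).toReal) 1 := by
  have h := ENNReal.hasSum_toReal (f := p) p.tsum_coe_ne_top
  rwa [← ENNReal.tsum_toReal_eq p.apply_ne_top, p.tsum_coe, ENNReal.toReal_one] at h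

/-- One step of the expected return of a policy, with its summability, which makes the infinite sum
in `policyValue` meaningful. -/
theorem hasSum_rollout_of_lt (M : MDP H X A) (π : Policy H X A) {t : ℕ} (ht : t < H) (x : X)
    {W : X → ℝ} (hW : ∀ x', HasSum
      (fun e => (rollout M π (t + 1) x' e).toReal * totalReward e) (W x')) :
    HasSum (fun e => (rollout M π t x e).toReal * totalReward e)
      (∑ o, (M (⟨t, ht⟩, x, π ⟨t, ht⟩ x)).1 o * ((o.1 : ℝ) + W o.2)) := by
  classical
  set y : Triple H X A := (⟨t, ht⟩, x, π ⟨t, ht⟩ x) with hy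
  set c : Outcome X → Episode H X A → Episode H X A := fun o e => (y, o) :: e with hc
  have hinj : ∀ o, Function.Injective (c o) := fun o => List.cons_injective
  have hf : (fun e => (rollout M π t x e).toReal * totalReward e) = fun e =>
      ∑ o, (M y).1 o * (((rollout M π (t + 1) o.2).map (c o) e).toReal * totalReward e) := by
    funext e
    rw [rollout, dif_pos ht, PMF.bind_apply, tsum_fintype, ENNReal.toReal_sum fun o _ =>
      ENNReal.mul_ne_top (PMF.apply_ne_top _ _) (PMF.apply_ne_top _ _), Finset.sum_mul]
    refine Finset.sum_congr rfl fun o _ => ?_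
    rw [ENNReal.toReal_mul, toReal_toPMF, mul_assoc]
  rw [hf]
  refine hasSum_sum fun o _ => HasSum.mul_left _ ?_
  rw [← (hinj o).hasSum_iff]
  · have h1 : ∀ e, (rollout M π (t + 1) o.2).map (c o) (c o e) = rollout M π (t + 1) o.2 e := by
      intro e
      rw [PMF.map_apply]
      exact (tsum_eq_single e fun e' he' => if_neg fun h => he' (hinj o h).symm).trans
        (if_pos rfl)
    have h2 : ∀ e, totalReward (c o e) = (o.1 : ℝ) + totalReward e := fun e => by
      simp [totalReward, hc]
    have h3 : ((fun e => ((rollout M π (t + 1) o.2).map (c o) e).toReal * totalReward e) ∘ c o) =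
        fun e => (rollout M π (t + 1) o.2 e).toReal * (o.1 : ℝ) +
          (rollout M π (t + 1) o.2 e).toReal * totalReward e := by
      funext e
      simp only [Function.comp_apply, h1, h2, mul_add]
    rw [h3]
    simpa using ((hasSum_toReal (rollout M π (t + 1) o.2)).mul_right (o.1 : ℝ)).add (hW o.2)
  · intro e he
    have : (rollout M π (t + 1) o.2).map (c o) e = 0 := by
      rw [PMF.map_apply, ENNReal.tsum_eq_zero]
      exact fun e' => if_neg fun h => he ⟨e', h.symm⟩
    rw [this, ENNReal.toReal_zero, zero_mul]

theorem hasSum_rollout_of_le (M : MDP H X A) (π : Policy H X A) {t : ℕ} (ht : H ≤ t) (x : X) :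
    HasSum (fun e => (rollout M π t x e).toReal * totalReward e) 0 := by
  have : (fun e => (rollout M π t x e).toReal * totalReward e) = fun _ => 0 := by
    funext e
    rw [rollout, dif_neg (not_lt.2 ht)]
    by_cases he : e = []
    · simp [he, totalReward]
    · simp [PMF.pure_apply, he]
  rw [this]
  exact hasSum_zero

theorem policyValue_of_le (M : MDP H X A) (π : Policy H X A) {t : ℕ} (ht : H ≤ t) (x : X) :
    policyValue M π t x = 0 :=
  (hasSum_rollout_of_le M π ht x).tsum_eq

theorem hasSum_policyValue (M : MDP H X A) (π : Policy H X A) (t : ℕ) (x : X) :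
    HasSum (fun e => (rollout M π t x e).toReal * totalReward e) (policyValue M π t x) := by
  refine Summable.hasSum ?_
  induction hm : H - t generalizing t x with
  | zero => exact (hasSum_rollout_of_le M π (by omega) x).summable
  | succ m ih =>
    exact (hasSum_rollout_of_lt M π (by omega) x
      fun x' => (ih (t + 1) x' (by omega)).hasSum).summable

theorem policyValue_of_lt (M : MDP H X A) (π : Policy H X A) {t : ℕ} (ht : t < H) (x : X) :
    policyValue M π t x = ∑ o, (M (⟨t, ht⟩, x, π ⟨t, ht⟩ x)).1 o *
      ((o.1 : ℝ) + policyValue M π (t + 1) o.2) :=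
  (hasSum_rollout_of_lt M π ht x fun x' => hasSum_policyValue M π (t + 1) x').tsum_eq

theorem continuous_mdp_apply (y : Triple H X A) (o : Outcome X) :
    Continuous fun M : MDP H X A => (M y).1 o :=
  (continuous_simplex_apply o).comp (continuous_apply y)

theorem continuous_policyValue (π : Policy H X A) (t : ℕ) (x : X) :
    Continuous fun M : MDP H X A => policyValue M π t x := by
  induction hm : H - t generalizing t x with
  | zero =>
    simp_rw [fun M : MDP H X A => policyValue_of_le M π (show H ≤ t by omega) x]
    exact continuous_const
  | succ m ih =>
    simp_rw [fun M : MDP H X A => policyValue_of_lt M π (show t < H by omega) x]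
    exact continuous_finsetSum _ fun o _ => (continuous_mdp_apply _ o).mul
      (continuous_const.add (ih (t + 1) o.2 (by omega)))

variable [Fintype A] [Nonempty A]

/-- The true Bellman operator of `M` in period `t`. -/
def trueBellman (M : MDP H X A) (t : Fin H) (Q : X → A → ℝ) (x : X) (a : A) : ℝ :=
  ∑ o, (M (t, x, a)).1 o *
    ((o.1 : ℝ) + Finset.univ.sup' Finset.univ_nonempty fun a' => Q o.2 a')

/-- The solution of the Bellman optimality recursion by backward induction, equal to `0` from period
`H` on. -/
def recQ (M : MDP H X A) (t : ℕ) : X → A → ℝ :=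
  if ht : t < H then trueBellman M ⟨t, ht⟩ (recQ M (t + 1)) else fun _ _ => 0
termination_by H - t

theorem recQ_of_lt (M : MDP H X A) {t : ℕ} (ht : t < H) :
    recQ M t = trueBellman M ⟨t, ht⟩ (recQ M (t + 1)) := by
  rw [recQ, dif_pos ht]

theorem recQ_of_le (M : MDP H X A) {t : ℕ} (ht : H ≤ t) : recQ M t = fun _ _ => 0 := by
  rw [recQ, dif_neg (not_lt.2 ht)]

/-- The optimal action values satisfy the Bellman optimality recursion; only the upper bound is
needed, since the test functions are nondecreasing. -/
theorem optQ_le_recQ [DecidableEq X] (M : MDP H X A) (t : ℕ) (x : X) (a : A) :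
    optQ M t x a ≤ recQ M t x a := by
  induction hm : H - t generalizing t x a with
  | zero =>
    rw [recQ_of_le M (by omega), optQ, dif_neg (by omega)]
  | succ m ih =>
    have ht : t < H := by omega
    rw [recQ_of_lt M ht, optQ, dif_pos ht]
    refine Finset.sum_le_sum fun o _ => mul_le_mul_of_nonneg_left ?_ ((M _).2.1 o)
    refine add_le_add le_rfl (Finset.sup'_le _ _ fun π _ => ?_)
    rcases lt_or_ge (t + 1) H with ht' | ht'
    · refine le_trans ?_ ((ih (t + 1) o.2 (π ⟨t + 1, ht'⟩ o.2) (by omega)).trans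
        (Finset.le_sup' (fun a' => recQ M (t + 1) o.2 a') (Finset.mem_univ _)))
      rw [policyValue_of_lt M π ht', optQ, dif_pos ht']
      refine Finset.sum_le_sum fun o' _ => mul_le_mul_of_nonneg_left ?_ ((M _).2.1 o')
      exact add_le_add le_rfl (Finset.le_sup' (fun π => policyValue M π (t + 1 + 1) o'.2)
        (Finset.mem_univ π))
    · rw [policyValue_of_le M π ht', recQ_of_le M ht']
      simp

theorem continuous_optQ [DecidableEq X] (t : ℕ) (x : X) (a : A) :
    Continuous fun M : MDP H X A => optQ M t x a := by
  by_cases ht : t < H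
  · simp only [optQ, dif_pos ht, optValue]
    exact continuous_finsetSum _ fun o _ => (continuous_mdp_apply _ o).mul
      (continuous_const.add (Continuous.finset_sup'_apply _ fun π _ =>
        continuous_policyValue π (t + 1) o.2))
  · simp only [optQ, dif_neg ht]
    exact continuous_const

theorem continuous_recQ (t : ℕ) : Continuous fun M : MDP H X A => recQ M t := by
  induction hm : H - t generalizing t with
  | zero =>
    simp_rw [fun M : MDP H X A => recQ_of_le M (show H ≤ t by omega)]
    exact continuous_const
  | succ m ih =>
    simp_rw [fun M : MDP H X A => recQ_of_lt M (show t < H by omega)]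
    have h := ih (t + 1) (by omega)
    refine continuous_pi fun x => continuous_pi fun a => ?_
    exact continuous_finsetSum _ fun o _ => (continuous_mdp_apply _ o).mul
      (continuous_const.add (Continuous.finset_sup'_apply _ fun a' _ =>
        (continuous_apply_apply o.2 a').comp h))

omit [Fintype X] [Fintype A] [Nonempty A] in
theorem reward_mem (o : Outcome X) : (0 : ℝ) ≤ (o.1 : ℕ) ∧ ((o.1 : ℕ) : ℝ) ≤ 1 := by
  refine ⟨Nat.cast_nonneg _, ?_⟩
  have : (o.1 : ℕ) ≤ 1 := by omega
  exact_mod_cast this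

theorem recQ_mem (M : MDP H X A) {t : ℕ} (ht : t ≤ H) (x : X) (a : A) :
    0 ≤ recQ M t x a ∧ recQ M t x a ≤ (H : ℝ) - t := by
  induction hm : H - t generalizing t x a with
  | zero =>
    rw [recQ_of_le M (by omega)]
    exact ⟨le_rfl, sub_nonneg.2 (by exact_mod_cast ht)⟩
  | succ m ih =>
    have ht' : t < H := by omega
    have h := fun x a => ih (t := t + 1) ht' x a (by omega)
    rw [recQ_of_lt M ht']
    constructor
    · refine Finset.sum_nonneg fun o _ => mul_nonneg ((M _).2.1 o)
        (add_nonneg (Nat.cast_nonneg _) ?_)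
      exact (h o.2 (Classical.arbitrary A)).1.trans
        (Finset.le_sup' (fun a' => recQ M (t + 1) o.2 a') (Finset.mem_univ _))
    · calc _ ≤ ∑ o, (M (⟨t, ht'⟩, x, a)).1 o * ((H : ℝ) - t) := by
            refine Finset.sum_le_sum fun o _ => mul_le_mul_of_nonneg_left ?_ ((M _).2.1 o)
            have h1 : Finset.univ.sup' Finset.univ_nonempty (fun a' => recQ M (t + 1) o.2 a') ≤
                (H : ℝ) - (t + 1 : ℕ) := Finset.sup'_le _ _ fun a' _ => (h o.2 a').2
            push_cast at h1
            linarith [(reward_mem o).2]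
        _ = _ := by rw [← Finset.sum_mul, (M _).2.2, one_mul]

theorem recQ_congr {M M' : MDP H X A} {t : ℕ} (h : ∀ y : Triple H X A, t ≤ y.1 → M y = M' y) :
    recQ M t = recQ M' t := by
  induction hm : H - t generalizing t with
  | zero => rw [recQ_of_le M (by omega), recQ_of_le M' (by omega)]
  | succ m ih =>
    have ht : t < H := by omega
    rw [recQ_of_lt M ht, recQ_of_lt M' ht,
      ih (fun y hy => h y (by omega)) (by omega)]
    funext x a
    simp only [trueBellman]
    rw [h (⟨t, ht⟩, x, a) le_rfl]

end Bellman

/-! ### Stochastic optimism of the sampled value functions -/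

section Optimism

open Agent

variable {H : ℕ} {X A : Type*}

theorem abs_sup'_sub_sup'_le [Fintype A] [Nonempty A] (f g : A → ℝ) :
    |Finset.univ.sup' Finset.univ_nonempty f - Finset.univ.sup' Finset.univ_nonempty g| ≤
      dist f g := by
  have key : ∀ f g : A → ℝ, Finset.univ.sup' Finset.univ_nonempty f ≤
      Finset.univ.sup' Finset.univ_nonempty g + dist f g := by
    refine fun f g => Finset.sup'_le _ _ fun a ha => ?_
    have h1 := (le_abs_self _).trans
      ((Real.dist_eq (f a) (g a)).symm.le.trans (dist_le_pi_dist f g a))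
    have h2 := Finset.le_sup' g ha
    linarith
  rw [abs_le]
  have h1 := key f g
  have h2 := key g f
  rw [dist_comm g f] at h2
  constructor <;> linarith

theorem sum_map_eq_sum_count {ι : Type*} [Fintype ι] [BEq ι] [LawfulBEq ι] (l : List ι)
    (f : ι → ℝ) : (l.map f).sum = ∑ o, (l.count o : ℝ) * f o := by
  classical
  induction l with
  | nil => simp
  | cons o l ih =>
    simp only [List.map_cons, List.sum_cons, ih, List.count_cons, Nat.cast_add, add_mul,
      Finset.sum_add_distrib]
    simp [add_comm]

variable [DecidableEq X] [DecidableEq A]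

theorem variance_pos {ag : Agent H X A} (hv : 0 < ag.v) (hl : 0 < ag.lam)
    (D : List (Transition H X A)) (y : Triple H X A) : 0 < ag.variance D y := by
  unfold Agent.variance
  positivity

theorem variance_eq {ag : Agent H X A} (hv : 0 < ag.v) {β : ℝ} (hratio : ag.v / ag.lam = β)
    (D : List (Transition H X A)) (y : Triple H X A) :
    ag.variance D y = ag.v / (β + (outcomes D y).length) := by
  rw [Agent.variance, ← hratio, ← inv_div]
  field_simp

variable [Fintype A] [Nonempty A]

theorem sampleQ_of_lt (ag : Agent H X A) (D : List (Transition H X A)) (z : Triple H X A → ℝ)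
    {t : ℕ} (ht : t < H) :
    ag.sampleQ D z t = ag.bellman D z ⟨t, ht⟩ (ag.sampleQ D z (t + 1)) := by
  rw [sampleQ, dif_pos ht]

theorem sampleQ_of_le (ag : Agent H X A) (D : List (Transition H X A)) (z : Triple H X A → ℝ)
    {t : ℕ} (ht : H ≤ t) : ag.sampleQ D z t = fun _ _ => 0 := by
  rw [sampleQ, dif_neg (not_lt.2 ht)]

theorem sampleQ_congr (ag : Agent H X A) (D : List (Transition H X A)) {z z' : Triple H X A → ℝ}
    {t : ℕ} (h : ∀ y : Triple H X A, t ≤ y.1 → z y = z' y) :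
    ag.sampleQ D z t = ag.sampleQ D z' t := by
  induction hm : H - t generalizing t with
  | zero => rw [sampleQ_of_le _ _ _ (by omega), sampleQ_of_le _ _ _ (by omega)]
  | succ m ih =>
    have ht : t < H := by omega
    rw [sampleQ_of_lt _ _ _ ht, sampleQ_of_lt _ _ _ ht, ih (fun y hy => h y (by omega)) (by omega)]
    funext x a
    simp only [bellman]
    rw [h (⟨t, ht⟩, x, a) le_rfl]

variable [Fintype X]

theorem bellman_mono {ag : Agent H X A} (hv : 0 < ag.v) (hl : 0 < ag.lam)
    (D : List (Transition H X A)) (z : Triple H X A → ℝ) (t : Fin H) :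
    Monotone (ag.bellman D z t) := by
  intro Q Q' hQ x a
  simp only [bellman, sum_map_eq_sum_count]
  refine add_le_add (mul_le_mul_of_nonneg_left (add_le_add le_rfl (mul_le_mul_of_nonneg_left
    (Finset.sum_le_sum fun o _ => mul_le_mul_of_nonneg_left (add_le_add le_rfl ?_)
      (Nat.cast_nonneg _)) (by positivity))) (variance_pos hv hl D _).le) le_rfl
  exact Finset.sup'_mono_fun fun a' _ => hQ o.2 a'

theorem bellman_convex {ag : Agent H X A} (hv : 0 < ag.v) (hl : 0 < ag.lam)
    (D : List (Transition H X A)) (z : Triple H X A → ℝ) (t : Fin H) (Q Q' : X → A → ℝ) {p q : ℝ}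
    (hp : 0 ≤ p) (hq : 0 ≤ q) (hpq : p + q = 1) :
    ag.bellman D z t (p • Q + q • Q') ≤ p • ag.bellman D z t Q + q • ag.bellman D z t Q' := by
  intro x a
  simp only [bellman, sum_map_eq_sum_count, Pi.add_apply, Pi.smul_apply, smul_eq_mul]
  set σ := ag.variance D (t, x, a)
  have hσ : 0 < σ := variance_pos hv hl D _
  have hmax : ∀ o : Outcome X,
      (Finset.univ.sup' Finset.univ_nonempty fun a' => p * Q o.2 a' + q * Q' o.2 a') ≤
        p * (Finset.univ.sup' Finset.univ_nonempty fun a' => Q o.2 a') +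
          q * (Finset.univ.sup' Finset.univ_nonempty fun a' => Q' o.2 a') := by
    refine fun o => Finset.sup'_le _ _ fun a' _ => add_le_add ?_ ?_
    · exact mul_le_mul_of_nonneg_left (Finset.le_sup' (fun a' => Q o.2 a') (Finset.mem_univ a')) hp
    · exact mul_le_mul_of_nonneg_left (Finset.le_sup' (fun a' => Q' o.2 a') (Finset.mem_univ a')) hq
  have hsum : ∑ o : Outcome X, ((outcomes D (t, x, a)).count o : ℝ) * ((o.1 : ℝ) +
        Finset.univ.sup' Finset.univ_nonempty fun a' => p * Q o.2 a' + q * Q' o.2 a') ≤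
      p * ∑ o : Outcome X, ((outcomes D (t, x, a)).count o : ℝ) * ((o.1 : ℝ) +
        Finset.univ.sup' Finset.univ_nonempty fun a' => Q o.2 a') +
      q * ∑ o : Outcome X, ((outcomes D (t, x, a)).count o : ℝ) * ((o.1 : ℝ) +
        Finset.univ.sup' Finset.univ_nonempty fun a' => Q' o.2 a') := by
    rw [Finset.mul_sum, Finset.mul_sum, ← Finset.sum_add_distrib]
    refine Finset.sum_le_sum fun o _ => ?_
    refine (mul_le_mul_of_nonneg_left (add_le_add le_rfl (hmax o))
      (Nat.cast_nonneg _)).trans_eq ?_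
    obtain rfl : q = 1 - p := by linarith
    ring
  refine le_trans (add_le_add (mul_le_mul_of_nonneg_left (add_le_add le_rfl
    (mul_le_mul_of_nonneg_left hsum (show 0 ≤ 1 / ag.v by positivity))) hσ.le) le_rfl)
    (le_of_eq ?_)
  obtain rfl : q = 1 - p := by linarith
  ring

/-- The operator is nonexpansive, because the weight `σ² n / v` of the data is at most one. -/
theorem lipschitzWith_bellman {ag : Agent H X A} (hv : 0 < ag.v) (hl : 0 < ag.lam)
    (D : List (Transition H X A)) (z : Triple H X A → ℝ) (t : Fin H) :
    LipschitzWith 1 (ag.bellman D z t) := by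
  refine LipschitzWith.of_dist_le_mul fun Q Q' => ?_
  rw [NNReal.coe_one, one_mul]
  refine (dist_pi_le_iff dist_nonneg).2 fun x => (dist_pi_le_iff dist_nonneg).2 fun a => ?_
  rw [Real.dist_eq]
  set l := outcomes D (t, x, a) with hlist
  have hσ := variance_pos hv hl D (t, x, a)
  have hw : ag.variance D (t, x, a) * (1 / ag.v * l.length) ≤ 1 := by
    rw [Agent.variance, ← hlist, inv_mul_le_iff₀ (by positivity), mul_one]
    have : 0 < 1 / ag.lam := by positivity
    have h2 : 1 / ag.v * (l.length : ℝ) = l.length / ag.v := by ring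
    linarith
  have hsum : ∀ l : List (Outcome X), |(l.map fun o =>
      (o.1 : ℝ) + Finset.univ.sup' Finset.univ_nonempty fun a' => Q o.2 a').sum -
      (l.map fun o => (o.1 : ℝ) + Finset.univ.sup' Finset.univ_nonempty fun a' => Q' o.2 a').sum|
        ≤ l.length * dist Q Q' := by
    intro l
    induction l with
    | nil => simp
    | cons o l ih =>
      have h1 := (abs_sup'_sub_sup'_le (Q o.2) (Q' o.2)).trans (dist_le_pi_dist Q Q' o.2)
      simp only [List.map_cons, List.sum_cons, List.length_cons, Nat.cast_add, Nat.cast_one]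
      rw [abs_le] at *
      constructor <;> nlinarith
  simp only [bellman, ← hlist]
  have hl2 := hsum l
  set S := (l.map fun o =>
      (o.1 : ℝ) + Finset.univ.sup' Finset.univ_nonempty fun a' => Q o.2 a').sum
  set S' := (l.map fun o =>
      (o.1 : ℝ) + Finset.univ.sup' Finset.univ_nonempty fun a' => Q' o.2 a').sum
  set σ := ag.variance D (t, x, a)
  have e : σ * (ag.priorMean (t, x, a) / ag.lam + 1 / ag.v * S) + √σ * z (t, x, a) -
      (σ * (ag.priorMean (t, x, a) / ag.lam + 1 / ag.v * S') + √σ * z (t, x, a)) =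
        σ * (1 / ag.v) * (S - S') := by ring
  rw [e, abs_mul, abs_of_nonneg (by positivity)]
  calc σ * (1 / ag.v) * |S - S'| ≤ σ * (1 / ag.v) * (l.length * dist Q Q') :=
        mul_le_mul_of_nonneg_left hl2 (by positivity)
    _ = σ * (1 / ag.v * l.length) * dist Q Q' := by ring
    _ ≤ 1 * dist Q Q' := mul_le_mul_of_nonneg_right hw dist_nonneg
    _ = dist Q Q' := one_mul _

/-- In its noise the operator is affine with slopes `√(σ²) ≤ √λ`. -/
theorem lipschitzWith_bellman_noise {ag : Agent H X A} (hv : 0 < ag.v) (hl : 0 < ag.lam)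
    (D : List (Transition H X A)) (t : Fin H) (Q : X → A → ℝ) :
    LipschitzWith (√ag.lam).toNNReal fun z => ag.bellman D z t Q := by
  refine LipschitzWith.of_dist_le_mul fun z z' => ?_
  rw [Real.coe_toNNReal _ (Real.sqrt_nonneg _)]
  have h0 : 0 ≤ √ag.lam * dist z z' := mul_nonneg (Real.sqrt_nonneg _) dist_nonneg
  refine (dist_pi_le_iff h0).2 fun x => (dist_pi_le_iff h0).2 fun a => ?_
  simp only [bellman]
  rw [dist_add_left, Real.dist_eq, ← mul_sub, abs_mul, abs_of_nonneg (Real.sqrt_nonneg _)]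
  refine mul_le_mul (Real.sqrt_le_sqrt ?_) (dist_le_pi_dist z z' _) (abs_nonneg _)
    (Real.sqrt_nonneg _)
  rw [Agent.variance]
  refine inv_le_of_inv_le₀ hl ?_
  rw [← one_div]
  have : 0 ≤ ((outcomes D (t, x, a)).length : ℝ) / ag.v := by positivity
  linarith

theorem exists_lipschitzWith_sampleQ {ag : Agent H X A} (hv : 0 < ag.v) (hl : 0 < ag.lam)
    (D : List (Transition H X A)) (t : ℕ) : ∃ K, LipschitzWith K fun z => ag.sampleQ D z t := by
  induction hm : H - t generalizing t with
  | zero =>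
    refine ⟨0, ?_⟩
    simp_rw [fun z => sampleQ_of_le ag D z (show H ≤ t by omega)]
    exact LipschitzWith.const _
  | succ m ih =>
    have ht : t < H := by omega
    obtain ⟨K, hK⟩ := ih (t + 1) (by omega)
    refine ⟨(√ag.lam).toNNReal + 1 * K, LipschitzWith.of_dist_le_mul fun z z' => ?_⟩
    simp only [sampleQ_of_lt ag D _ ht]
    refine (dist_triangle _ (ag.bellman D z' ⟨t, ht⟩ (ag.sampleQ D z (t + 1))) _).trans ?_
    rw [NNReal.coe_add, add_mul]
    refine add_le_add ?_ ?_
    · exact (lipschitzWith_bellman_noise hv hl D ⟨t, ht⟩ _).dist_le_mul z z'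
    · exact ((lipschitzWith_bellman hv hl D z' ⟨t, ht⟩).comp hK).dist_le_mul z z'

omit [DecidableEq X] [DecidableEq A] [Nonempty A] in
theorem integrable_noise_of_lipschitzWith {U : (Triple H X A → ℝ) → ℝ} {C : NNReal}
    (hU : LipschitzWith C U) : Integrable U (noise H X A) :=
  integrable_of_lipschitzWith_pi _ (fun _ => integrable_id_gaussianReal 0 1) hU

/-- One application of the Bellman operators: for a fixed value function with values in `[0, H]`
the posterior law of the true operator is dominated by the law of the randomized operator. -/
theorem integral_trueBellman_le [Nonempty X] {ag : Agent H X A} (hv : 0 < ag.v) (hl : 0 < ag.lam)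
    {α : Triple H X A → Outcome X → ℝ} {β : ℝ} (hα : ∀ y o, 0 < α y o) (hβ : 0 < β)
    (hsum : ∀ y, ∑ o, α y o = β) (hratio : ag.v / ag.lam = β) (hvH : (H : ℝ) ^ 2 ≤ ag.v)
    (hmean : ∀ y, (H : ℝ) ≤ ag.priorMean y) (D : List (Transition H X A)) (t : Fin H)
    {Q : X → A → ℝ} (hQ0 : ∀ x a, 0 ≤ Q x a) (hQ1 : ∀ x a, Q x a ≤ (H : ℝ) - 1)
    {U : (X → A → ℝ) → ℝ} (hc : ConvexOn ℝ Set.univ U) (hm : Monotone U) {C : NNReal}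
    (hL : LipschitzWith C U) :
    ∫ M, U (trueBellman M t Q) ∂prior (posteriorParam α D) ≤
      ∫ z, U (ag.bellman D z t Q) ∂noise H X A := by
  have hH : (0 : ℝ) < H := by exact_mod_cast t.pos
  set V : Outcome X → ℝ := fun o =>
    (o.1 : ℝ) + Finset.univ.sup' Finset.univ_nonempty fun a' => Q o.2 a' with hV
  have hV0 : ∀ o, 0 ≤ V o := fun o => add_nonneg (Nat.cast_nonneg _)
    ((hQ0 o.2 (Classical.arbitrary A)).trans
      (Finset.le_sup' (fun a' => Q o.2 a') (Finset.mem_univ _)))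
  have hVH : ∀ o, V o ≤ H := fun o => by
    have h1 : Finset.univ.sup' Finset.univ_nonempty (fun a' => Q o.2 a') ≤ (H : ℝ) - 1 :=
      Finset.sup'_le _ _ fun a' _ => hQ1 o.2 a'
    have h2 := (reward_mem o).2
    simp only [hV]
    linarith
  have hpos := posteriorParam_pos hα D
  have hp := fun y => isProbabilityMeasure_dirichlet (posteriorParam α D y) (hpos y)
  set m : Triple H X A → ℝ := fun y => ag.variance D y *
    (ag.priorMean y / ag.lam + 1 / ag.v * ((outcomes D y).map V).sum) with hmdef
  set dot : Triple H X A → stdSimplex ℝ (Outcome X) → ℝ := fun _ p => ∑ o, p.1 o * V o with hdot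
  have hdotc : ∀ y, Continuous (dot y) := fun y => continuous_simplex_dot V
  set aff : Triple H X A → ℝ → ℝ := fun y z => m y + √(ag.variance D y) * z with haff
  have haffc : ∀ y, Continuous (aff y) := fun y => by fun_prop
  have hpμ : ∀ y, IsProbabilityMeasure ((dirichlet (posteriorParam α D y)).map (dot y)) := fun y =>
    Measure.isProbabilityMeasure_map (hdotc y).aemeasurable
  have hpν : ∀ y, IsProbabilityMeasure ((gaussianReal 0 1).map (aff y)) := fun y =>
    Measure.isProbabilityMeasure_map (haffc y).aemeasurable
  set W : (Triple H X A → ℝ) → ℝ := fun g => U fun x a => g (t, x, a) with hW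
  have hWL : LipschitzWith C W := by
    refine LipschitzWith.of_dist_le_mul fun g g' => (hL.dist_le_mul _ _).trans
      (mul_le_mul_of_nonneg_left ?_ C.2)
    exact (dist_pi_le_iff dist_nonneg).2 fun x => (dist_pi_le_iff dist_nonneg).2 fun a =>
      dist_le_pi_dist g g' (t, x, a)
  have key := integral_pi_le_integral_pi
    (fun y => (dirichlet (posteriorParam α D y)).map (dot y))
    (fun y => (gaussianReal 0 1).map (aff y)) ?_ ?_ ?_ (U := W)
    ⟨convex_univ, fun g _ g' _ p q hp hq hpq => hc.2 (Set.mem_univ _) (Set.mem_univ _) hp hq hpq⟩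
    (fun g g' hg => hm fun x a => hg (t, x, a)) hWL
  · have hdotm : Measurable fun (p : Triple H X A → stdSimplex ℝ (Outcome X)) y => dot y (p y) :=
      measurable_pi_lambda _ fun y => (hdotc y).measurable.comp (measurable_pi_apply y)
    have haffm : Measurable fun (z : Triple H X A → ℝ) y => aff y (z y) :=
      measurable_pi_lambda _ fun y => (haffc y).measurable.comp (measurable_pi_apply y)
    rw [← Measure.pi_map_pi fun y => (hdotc y).aemeasurable,
      ← Measure.pi_map_pi fun y => (haffc y).aemeasurable,
      integral_map hdotm.aemeasurable hWL.continuous.aestronglyMeasurable,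
      integral_map haffm.aemeasurable hWL.continuous.aestronglyMeasurable] at key
    exact key
  · intro y
    rw [integrable_map_measure (by fun_prop) (hdotc y).aemeasurable]
    exact integrable_of_continuous_compact (hdotc y)
  · intro y
    rw [integrable_map_measure (by fun_prop) (haffc y).aemeasurable]
    exact (integrable_const _).add ((integrable_id_gaussianReal 0 1).const_mul _)
  · rintro y φ hφc hφm ⟨K, hφL⟩
    rw [integral_map (hdotc y).aemeasurable hφL.continuous.aestronglyMeasurable,
      integral_map (haffc y).aemeasurable hφL.continuous.aestronglyMeasurable]
    have hN : 0 < β + ((outcomes D y).length : ℝ) := by positivity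
    have hvar := variance_eq hv hratio D y
    refine integral_dirichlet_le_integral_gaussianReal _ (hpos y) hH hV0 hVH hφc hφm hφL ?_ ?_
    · rw [sum_posteriorParam, hsum]
      have h1 : ∑ o, posteriorParam α D y o * V o =
          ∑ o, α y o * V o + ((outcomes D y).map V).sum := by
        rw [sum_map_eq_sum_count, ← Finset.sum_add_distrib]
        exact Finset.sum_congr rfl fun o _ => by rw [posteriorParam, add_mul]
      have h2 : ∑ o, α y o * V o ≤ β * ag.priorMean y := by
        rw [← hsum y, Finset.sum_mul]
        exact Finset.sum_le_sum fun o _ =>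
          mul_le_mul_of_nonneg_left ((hVH o).trans (hmean y)) (hα y o).le
      have h3 : m y = (β * ag.priorMean y + ((outcomes D y).map V).sum) /
          (β + (outcomes D y).length) := by
        simp only [hmdef]
        rw [hvar, ← hratio]
        field_simp
      rw [h1, h3]
      exact div_le_div_of_nonneg_right (by linarith) hN.le
    · rw [sum_posteriorParam, hsum, Real.sq_sqrt (variance_pos hv hl D y).le, hvar]
      exact div_le_div_of_nonneg_right hvH hN.le

/-- Domination of the true by the sampled value functions, by backward induction on the period.
Conditionally on the value function of the next period, the Bellman operators are exchanged by
`integral_trueBellman_le`; the randomized operator preserves convex nondecreasing test functions, so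
that the induction hypothesis applies. -/
theorem integral_recQ_le [Nonempty X] {ag : Agent H X A} (hv : 0 < ag.v) (hl : 0 < ag.lam)
    {α : Triple H X A → Outcome X → ℝ} {β : ℝ} (hα : ∀ y o, 0 < α y o) (hβ : 0 < β)
    (hsum : ∀ y, ∑ o, α y o = β) (hratio : ag.v / ag.lam = β) (hvH : (H : ℝ) ^ 2 ≤ ag.v)
    (hmean : ∀ y, (H : ℝ) ≤ ag.priorMean y) (D : List (Transition H X A)) (t : ℕ)
    {U : (X → A → ℝ) → ℝ} (hc : ConvexOn ℝ Set.univ U) (hm : Monotone U) {C : NNReal}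
    (hL : LipschitzWith C U) :
    ∫ M, U (recQ M t) ∂prior (posteriorParam α D) ≤
      ∫ z, U (ag.sampleQ D z t) ∂noise H X A := by
  have hprior := isProbabilityMeasure_prior (posteriorParam_pos hα D)
  have hdir := fun y =>
    isProbabilityMeasure_dirichlet (posteriorParam α D y) (posteriorParam_pos hα D y)
  induction hn : H - t generalizing t U with
  | zero =>
    have ht : H ≤ t := by omega
    simp_rw [fun M : MDP H X A => recQ_of_le M ht, fun z => sampleQ_of_le ag D z ht]
    simp
  | succ k ih =>
    have ht : t < H := by omega
    have hi : ∀ Q, Integrable (fun z => U (ag.bellman D z ⟨t, ht⟩ Q)) (noise H X A) := fun Q =>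
      integrable_noise_of_lipschitzWith (hL.comp (lipschitzWith_bellman_noise hv hl D ⟨t, ht⟩ Q))
    set G : (X → A → ℝ) → ℝ := fun Q => ∫ z, U (ag.bellman D z ⟨t, ht⟩ Q) ∂noise H X A with hG
    have hGc : ConvexOn ℝ Set.univ G := by
      refine integral_convexOn_of_integrand_ae convex_univ (ae_of_all _ fun z => ?_)
        fun Q _ => hi Q
      refine ⟨convex_univ, fun Q _ Q' _ p q hp hq hpq => ?_⟩
      exact (hm (bellman_convex hv hl D z _ Q Q' hp hq hpq)).trans
        (hc.2 (Set.mem_univ _) (Set.mem_univ _) hp hq hpq)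
    have hGm : Monotone G := fun Q Q' hQ =>
      integral_mono (hi Q) (hi Q') fun z => hm (bellman_mono hv hl D z _ hQ)
    have hGL : LipschitzWith C G := lipschitzWith_integral hi fun z => by
      have := hL.comp (lipschitzWith_bellman hv hl D z ⟨t, ht⟩)
      rwa [mul_one] at this
    -- the transitions of period `t` are independent of the value function of period `t + 1`
    have hrec : ∀ M M' : MDP H X A, recQ (fun y => if (y.1 : ℕ) = t then M' y else M y) t =
        trueBellman M' ⟨t, ht⟩ (recQ M (t + 1)) := by
      intro M M'
      rw [recQ_of_lt _ ht, recQ_congr (M' := M) fun y hy => if_neg (by omega)]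
      funext x a
      simp [trueBellman]
    have hsam : ∀ z z' : Triple H X A → ℝ,
        ag.sampleQ D (fun y => if (y.1 : ℕ) = t then z' y else z y) t =
          ag.bellman D z' ⟨t, ht⟩ (ag.sampleQ D z (t + 1)) := by
      intro z z'
      rw [sampleQ_of_lt _ _ _ ht, sampleQ_congr (z' := z) ag D fun y hy => if_neg (by omega)]
      funext x a
      simp [bellman]
    have hUrec : Integrable (fun M => U (recQ M t)) (prior (posteriorParam α D)) :=
      integrable_of_continuous_compact (hL.continuous.comp (continuous_recQ t))
    have hUsam : Integrable (fun z => U (ag.sampleQ D z t)) (noise H X A) := by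
      obtain ⟨K, hK⟩ := exists_lipschitzWith_sampleQ hv hl D t
      exact integrable_noise_of_lipschitzWith (hL.comp hK)
    obtain ⟨i1, e1⟩ := integral_piecewise_pi (fun y => dirichlet (posteriorParam α D y))
      (fun y => (y.1 : ℕ) = t) hUrec
    obtain ⟨-, e2⟩ := integral_piecewise_pi (fun _ : Triple H X A => gaussianReal 0 1)
      (fun y => (y.1 : ℕ) = t) hUsam
    simp_rw [hrec] at i1 e1
    simp_rw [hsam] at e2
    refine (e1.trans_le ?_).trans ((ih (t + 1) hGc hGm hGL (by omega)).trans_eq e2.symm)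
    refine integral_mono i1 (integrable_of_continuous_compact
      (hGL.continuous.comp (continuous_recQ (t + 1)))) fun M => ?_
    refine integral_trueBellman_le hv hl hα hβ hsum hratio hvH hmean D ⟨t, ht⟩
      (fun x a => (recQ_mem M ht x a).1) (fun x a => (recQ_mem M ht x a).2.trans ?_) hc hm hL
    push_cast
    have : (0 : ℝ) ≤ t := Nat.cast_nonneg t
    linarith

theorem expectation_eq_integral {Ω : Type*} [MeasurableSpace Ω] {μ : Measure Ω} {f : Ω → ℝ}
    (hf : Integrable f μ) : expectation μ f = ((∫ ω, f ω ∂μ : ℝ) : EReal) := by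
  have h1 : ∫⁻ ω, ENNReal.ofReal (f ω) ∂μ ≠ ⊤ := hf.lintegral_lt_top.ne
  have h2 : ∫⁻ ω, ENNReal.ofReal (-f ω) ∂μ ≠ ⊤ := hf.neg.lintegral_lt_top.ne
  rw [expectation, integral_eq_lintegral_pos_part_sub_lintegral_neg_part hf, EReal.coe_sub,
    EReal.coe_ennreal_toReal h1, EReal.coe_ennreal_toReal h2]

theorem expectation_mono {Ω : Type*} [MeasurableSpace Ω] {μ : Measure Ω} {f g : Ω → ℝ}
    (h : ∀ ω, f ω ≤ g ω) : expectation μ f ≤ expectation μ g := by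
  refine EReal.sub_le_sub ?_ ?_ <;> rw [EReal.coe_ennreal_le_coe_ennreal_iff]
  · exact lintegral_mono fun ω => ENNReal.ofReal_le_ofReal (h ω)
  · exact lintegral_mono fun ω => ENNReal.ofReal_le_ofReal (neg_le_neg (h ω))

end Optimism

end

end RLSVI

theorem mainTheorem2 {H : ℕ} {X A : Type*} [Fintype X] [DecidableEq X] [Fintype A] [DecidableEq A]
    [Nonempty A] (ρ : PMF X)
    (α : RLSVI.Triple H X A → RLSVI.Outcome X → ℝ) (β : ℝ) (hα : ∀ y o, 0 < α y o) (hβ : 2 ≤ β)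
    (hsum : ∀ y, ∑ o, α y o = β)
    (ag : RLSVI.Agent H X A) (hratio : ag.v / ag.lam = β) (hv : (H : ℝ) ^ 2 ≤ ag.v)
    (hmean : ∀ y, (H : ℝ) ≤ ag.priorMean y)
    (n : ℕ) (h : RLSVI.History H X A)
    (hh : ag.jointLaw ρ α n {ω | ω.1.2 = h} ≠ 0) (x : X) (a : A) :
    Integrable (fun ω => ag.sampleQ ω.1.2.buffer ω.2 0 x a)
        (ProbabilityTheory.cond (ag.jointLaw ρ α n) {ω | ω.1.2 = h}) ∧
      Integrable (fun ω => RLSVI.optQ ω.1.1 0 x a)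
        (ProbabilityTheory.cond (ag.jointLaw ρ α n) {ω | ω.1.2 = h}) ∧
      RLSVI.StochasticallyOptimistic
        (ProbabilityTheory.cond (ag.jointLaw ρ α n) {ω | ω.1.2 = h})
        (fun ω => ag.sampleQ ω.1.2.buffer ω.2 0 x a) (fun ω => RLSVI.optQ ω.1.1 0 x a) := by
  have hX : Nonempty X := ⟨x⟩
  have hv0 : 0 < ag.v := by
    refine lt_of_le_of_ne ((sq_nonneg _).trans hv) fun h0 => ?_
    rw [← h0, zero_div] at hratio
    linarith
  have hl0 : 0 < ag.lam := by
    by_contra hl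
    have := div_nonpos_of_nonneg_of_nonpos hv0.le (not_lt.1 hl)
    linarith
  have hjoint := ag.isProbabilityMeasure_jointLaw ρ α hα n
  have hmap := RLSVI.map_cond_jointLaw ag ρ hα n h hh
  have hpost := RLSVI.isProbabilityMeasure_prior (RLSVI.posteriorParam_pos hα h.buffer)
  have hcond : IsProbabilityMeasure
      (ProbabilityTheory.cond (ag.jointLaw ρ α n) {ω | ω.1.2 = h}) :=
    cond_isProbabilityMeasure hh
  set P := ProbabilityTheory.cond (ag.jointLaw ρ α n) {ω | ω.1.2 = h} with hP
  have hfst : MeasurePreserving (fun ω => ω.1.1) P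
      (RLSVI.Agent.prior (RLSVI.posteriorParam α h.buffer)) := by
    refine ⟨by fun_prop, ?_⟩
    rw [← Measure.fst_prod (μ := RLSVI.Agent.prior (RLSVI.posteriorParam α h.buffer))
      (ν := RLSVI.Agent.noise H X A), ← hmap, Measure.fst, Measure.map_map (by fun_prop)
      (by fun_prop)]
    rfl
  have hsnd : MeasurePreserving (fun ω => ω.2) P (RLSVI.Agent.noise H X A) := by
    refine ⟨by fun_prop, ?_⟩
    rw [← Measure.snd_prod (μ := RLSVI.Agent.prior (RLSVI.posteriorParam α h.buffer))
      (ν := RLSVI.Agent.noise H X A), ← hmap, Measure.snd, Measure.map_map (by fun_prop)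
      (by fun_prop)]
    rfl
  have hbuf : ∀ᵐ ω ∂P, ω.1.2 = h :=
    ae_cond_mem ((measurable_snd.comp measurable_fst) (MeasurableSet.singleton h))
  -- integrability of Lipschitz functions of the sampled value
  have hsam : ∀ v : ℝ → ℝ, (∃ C, LipschitzWith C v) →
      Integrable (fun ω => v (ag.sampleQ ω.1.2.buffer ω.2 0 x a)) P ∧
        ∫ ω, v (ag.sampleQ ω.1.2.buffer ω.2 0 x a) ∂P =
          ∫ z, v (ag.sampleQ h.buffer z 0 x a) ∂(RLSVI.Agent.noise H X A) := by
    rintro v ⟨C, hC⟩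
    obtain ⟨K, hK⟩ := RLSVI.exists_lipschitzWith_sampleQ hv0 hl0 h.buffer 0
    have hLip : LipschitzWith (C * (1 * (1 * K))) fun z => v (ag.sampleQ h.buffer z 0 x a) :=
      hC.comp ((LipschitzWith.eval a).comp ((LipschitzWith.eval x).comp hK))
    have hi := RLSVI.integrable_noise_of_lipschitzWith hLip
    have hae : (fun ω : (RLSVI.MDP H X A × RLSVI.History H X A) × (RLSVI.Triple H X A → ℝ) =>
        v (ag.sampleQ h.buffer ω.2 0 x a)) =ᵐ[P]
          fun ω => v (ag.sampleQ ω.1.2.buffer ω.2 0 x a) := by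
      filter_upwards [hbuf] with ω hω
      rw [hω]
    refine ⟨((hsnd.integrable_comp hi.aestronglyMeasurable).2 hi).congr hae, ?_⟩
    rw [← integral_congr_ae hae, ← hsnd.map_eq, integral_map hsnd.aemeasurable
      (by rw [hsnd.map_eq]; exact hi.aestronglyMeasurable)]
  have hopt : ∀ v : ℝ → ℝ, Continuous v → Integrable (fun ω => v (RLSVI.optQ ω.1.1 0 x a)) P ∧
      ∫ ω, v (RLSVI.optQ ω.1.1 0 x a) ∂P =
        ∫ M, v (RLSVI.optQ M 0 x a) ∂(RLSVI.Agent.prior (RLSVI.posteriorParam α h.buffer)) := by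
    intro v hvc
    have hi := RLSVI.integrable_of_continuous_compact
      (μ := RLSVI.Agent.prior (RLSVI.posteriorParam α h.buffer))
      (hvc.comp (RLSVI.continuous_optQ (H := H) (X := X) (A := A) 0 x a))
    refine ⟨(hfst.integrable_comp hi.aestronglyMeasurable).2 hi, ?_⟩
    rw [← hfst.map_eq, integral_map hfst.aemeasurable
      (by rw [hfst.map_eq]; exact hi.aestronglyMeasurable)]
  refine ⟨(hsam id ⟨1, LipschitzWith.id⟩).1, (hopt id continuous_id).1, fun u huc hum => ?_⟩
  -- `Q*` is bounded by `H`, so that `u` may be replaced by a Lipschitz minorant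
  obtain ⟨v, hvc, hvm, ⟨C, hvL⟩, hvu, hvle⟩ := RLSVI.exists_lipschitz_minorant huc hum H
  have hoptH : ∀ M : RLSVI.MDP H X A, RLSVI.optQ M 0 x a ≤ H := fun M =>
    (RLSVI.optQ_le_recQ M 0 x a).trans (by simpa using (RLSVI.recQ_mem M (Nat.zero_le H) x a).2)
  simp_rw [fun M : RLSVI.MDP H X A => (hvu _ (hoptH M)).symm]
  obtain ⟨i1, e1⟩ := hopt v hvL.continuous
  obtain ⟨i2, e2⟩ := hsam v ⟨C, hvL⟩
  refine le_trans ?_ (RLSVI.expectation_mono fun ω => hvle _)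
  rw [RLSVI.expectation_eq_integral i1, RLSVI.expectation_eq_integral i2, EReal.coe_le_coe_iff,
    e1, e2]
  have hrec : Continuous fun M : RLSVI.MDP H X A => RLSVI.recQ M 0 x a :=
    (continuous_apply_apply x a).comp (RLSVI.continuous_recQ 0)
  refine (integral_mono (RLSVI.integrable_of_continuous_compact
    (hvL.continuous.comp (RLSVI.continuous_optQ 0 x a)))
    (RLSVI.integrable_of_continuous_compact (hvL.continuous.comp hrec))
    fun M => hvm (RLSVI.optQ_le_recQ M 0 x a)).trans ?_
  exact RLSVI.integral_recQ_le hv0 hl0 hα (by linarith) hsum hratio hv hmean h.buffer 0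
    (U := fun Q => v (Q x a))
    ⟨convex_univ, fun Q _ Q' _ p q hp hq hpq =>
      hvc.2 (Set.mem_univ _) (Set.mem_univ _) hp hq hpq⟩
    (fun Q Q' hQ => hvm (hQ x a))
    (hvL.comp ((LipschitzWith.eval a).comp (LipschitzWith.eval x)))
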